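/- An alphabet $\Sigma$ is a finite set. A parameterization of $\Sigma$ is a map $\kappa:\Sigma^*\to\mathbb{Z}^+$ computable in polynomial time (values written in binary); a parameterized problem is a pair $(L,\kappa)$ of a language $L\subseteq\Sigma^*$ and a parameterization $\kappa$ of $\Sigma$, for some alphabet $\Sigma$. Quantum circuits are built from a fixed finite universal gate set (NOT, Hadamard, $\mathrm{T}=\mathrm{diag}(1,e^{i\pi/4})$, CNOT). The size of a circuit is its number of qubits plus its number of gates. A circuit is run on $|0\cdots0\rangle$ and accepts if a computational-basis measurement of its output qubit gives $1$. A family of circuits $\{C_x\}_{x\in\Sigma^*}$ decides $L\subseteq\Sigma^*$ with bounded error if, for every $x\in\Sigma^*$, $\Pr[C_x\text{ accepts}]\geq\frac23$ if $x\in L$ and $\Pr[C_x\text{ accepts}]\leq\frac13$ if $x\notin L$. * $\mathrm{P}$ is the class of languages (over all alphabets) that are decided by a deterministic Turing machine in time polynomial in $|x|$. * $\mathrm{BQP}$ is the class of languages $L$ that are decided with bounded error by a polynomial-time uniform family $\{C_x\}$ of quantum circuits of size polynomial in $|x|$. Polynomial-time uniform means that a deterministic Turing machine, on input $x$, outputs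 a description of $C_x$ in time polynomial in $|x|$. * $\mathrm{FPT}$ is the class of parameterized problems $(L,\kappa)$ such that $L$ is decided by a deterministic Turing machine in time at most $f(\kappa(x))\cdot p(|x|)$ on every input $x$, for some computable function $f$ and some polynomial $p$ with natural coefficients. * $\mathrm{FPQT}$ is the class of parameterized problems $(L,\kappa)$ such that $L$ is decided with bounded error by an FPT-uniform family $\{C_x\}$ of quantum circuits, $C_x$ being of size at most $f(\kappa(x))\cdot p(|x|)$, for some computable function $f$ and some polynomial $p$ with natural coefficients. FPT-uniform means that a deterministic Turing machine, on input $x$, outputs a description of $C_x$ in time at most $g(\kappa(x))\cdot q(|x|)$, for some computable function $g$ and some polynomial $q$ with natural coefficients. **Proposition.** $\mathrm{FPT}=\mathrm{FPQT}$ if and only if $\mathrm{P}=\mathrm{BQP}$. -/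

import Mathlib

namespace QParam

/-! ### Deterministic time (multi-stack Turing machines) -/

/-- The string function `F` is computed by a deterministic Turing machine that, on every input
string `x`, halts within `t x` steps with `F x` on its output tape. -/
def ComputesInTime {Γ₀ Γ₁ : Type} (F : List Γ₀ → List Γ₁) (t : List Γ₀ → ℕ) : Prop :=
  ∃ M : Turing.TM2ComputableAux Γ₀ Γ₁, ∀ x : List Γ₀,
    Nonempty (Turing.TM2OutputsInTime M.tm (x.map M.inputAlphabet.symm)
      (some ((F x).map M.outputAlphabet.symm)) (t x))

/-- `t` is bounded by a polynomial in the input length. -/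
def PolyBounded {Γ : Type} (t : List Γ → ℕ) : Prop :=
  ∃ p : Polynomial ℕ, ∀ x, t x ≤ p.eval x.length

/-- `t` is bounded by `f (κ x) * p |x|` for a computable function `f` and a polynomial `p`. (Only
the values of `f` at positive integers matter, and they may be taken positive: replace `f` by
`f + 1`.) -/
def FPTBounded {Γ : Type} (κ : List Γ → ℕ+) (t : List Γ → ℕ) : Prop :=
  ∃ f : ℕ → ℕ, Computable f ∧ ∃ p : Polynomial ℕ, ∀ x, t x ≤ f (κ x) * p.eval x.length

open Classical in
/-- A deterministic Turing machine decides membership in `L`, within `t x` steps on input `x`. -/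
def DecidesInTime {Γ : Type} (L : Language Γ) (t : List Γ → ℕ) : Prop :=
  ComputesInTime (fun x => [decide (x ∈ L)]) t

/-! ### Quantum circuits -/

/-- Gates acting on `n` qubits, from the finite universal gate set consisting of the NOT gate `X`,
the Hadamard gate `H`, the `π/8` gate `T = diag(1, exp (iπ/4))`, and the controlled-NOT gate. -/
inductive Gate (n : ℕ) : Type
  | X (i : Fin n) : Gate n
  | H (i : Fin n) : Gate n
  | T (i : Fin n) : Gate n
  | CNOT (control target : Fin n) (h : control ≠ target) : Gate n

/-- A state vector of `n` qubits: its amplitudes in the computational basis. -/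
abbrev QState (n : ℕ) : Type := (Fin n → Bool) → ℂ

/-- The initial state `|0…0⟩`. -/
def zeroState (n : ℕ) : QState n := Pi.single (fun _ => false) 1

/-- The unitary action of a gate on state vectors. -/
noncomputable def Gate.apply {n : ℕ} : Gate n → QState n → QState n
  | .X i, ψ => fun b => ψ (Function.update b i (!b i))
  | .H i, ψ => fun b =>
      (ψ (Function.update b i false) + (if b i then -1 else 1) * ψ (Function.update b i true))
        / (Real.sqrt 2 : ℂ)
  | .T i, ψ => fun b => (if b i then Complex.exp (Complex.I * Real.pi / 4) else 1) * ψ b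
  | .CNOT c t _, ψ => fun b => ψ (Function.update b t (xor (b t) (b c)))

/-- A quantum circuit on the output qubit `0` and `ancillas` further qubits; the gates are applied
from left to right. -/
structure QCircuit where
  ancillas : ℕ
  gates : List (Gate (ancillas + 1))

/-- The size of a circuit: the number of its qubits plus the number of its gates. -/
def QCircuit.size (C : QCircuit) : ℕ := (C.ancillas + 1) + C.gates.length

/-- The state of the circuit after it has been run on `|0…0⟩`. -/
noncomputable def QCircuit.finalState (C : QCircuit) : QState (C.ancillas + 1) :=
  C.gates.foldl (fun ψ g => g.apply ψ) (zeroState _)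

/-- The probability that the circuit, run on `|0…0⟩`, accepts: the outcome of measuring the output
qubit in the computational basis is `1`. -/
noncomputable def QCircuit.acceptProb (C : QCircuit) : ℝ :=
  ∑ b : Fin (C.ancillas + 1) → Bool, if b 0 then ‖C.finalState b‖ ^ 2 else 0

/-- The alphabet in which descriptions of circuits are written. -/
inductive CSymbol : Type
  | x | h | t | cnot | sep | one

/-- The description of a gate: its name followed by its qubits in unary. -/
def Gate.encode {n : ℕ} : Gate n → List CSymbol
  | .X i => .x :: List.replicate i .one
  | .H i => .h :: List.replicate i .one
  | .T i => .t :: List.replicate i .one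
  | .CNOT c t _ => .cnot :: (List.replicate c .one ++ .sep :: List.replicate t .one)

/-- The description of a circuit: the number of ancillas in unary, followed by the gates. It
determines the circuit, and its length is polynomially related to the size of the circuit. -/
def QCircuit.encode (C : QCircuit) : List CSymbol :=
  List.replicate C.ancillas .one ++ C.gates.flatMap Gate.encode

/-- The family of circuits `C x`, one for each input `x` (which is hard-wired into `C x`), decides `L` with error probability at
most `1/3`. -/
def BoundedErrorDecides {Γ : Type} (C : List Γ → QCircuit) (L : Language Γ) : Prop :=
  ∀ x, (x ∈ L → 2 / 3 ≤ (C x).acceptProb) ∧ (x ∉ L → (C x).acceptProb ≤ 1 / 3)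

/-! ### Problems and parameterized problems -/

/-- A decision problem: a language over a finite alphabet. -/
structure Problem where
  alphabet : Type
  [finite : Finite alphabet]
  lang : Language alphabet

/-- A parameterized problem: a language over a finite alphabet together with a parameterization,
that is, a map to the positive integers that is computable in polynomial time (the value being
written in binary). -/
structure ParamProblem extends Problem where
  κ : List alphabet → ℕ+
  κ_polyTime : ∃ t, PolyBounded t ∧ ComputesInTime (fun x => Computability.encodeNat (κ x)) t

/-! ### The complexity classes -/

/-- P: problems decided by a deterministic Turing machine in polynomial time. -/
def ClassP : Set Problem :=
  {A | ∃ t, PolyBounded t ∧ DecidesInTime A.lang t}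

/-- BQP: problems decided with error probability at most `1/3` by a polynomial-time uniform family
of quantum circuits of polynomial size: on input `x`, a deterministic Turing machine outputs the
description of the circuit `C x` in polynomial time. -/
def ClassBQP : Set Problem :=
  {A | ∃ C : List A.alphabet → QCircuit,
    (∃ t, PolyBounded t ∧ ComputesInTime (fun x => (C x).encode) t) ∧
    PolyBounded (fun x => (C x).size) ∧
    BoundedErrorDecides C A.lang}

/-- FPT: parameterized problems decided by a deterministic Turing machine in time
`f (κ x) * p |x|` for a computable function `f` and a polynomial `p`. -/
def ClassFPT : Set ParamProblem :=
  {A | ∃ t, FPTBounded A.κ t ∧ DecidesInTime A.lang t}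

/-- FPQT: parameterized problems decided with error probability at most `1/3` by an FPT-uniform
family of quantum circuits of size at most `f (κ x) * p |x|` for a computable function `f` and a
polynomial `p`. FPT-uniform: on input `x`, a deterministic Turing machine outputs the description of
the circuit `C x` in time `g (κ x) * q |x|` for a computable function `g` and a polynomial `q`. -/
def ClassFPQT : Set ParamProblem :=
  {A | ∃ C : List A.alphabet → QCircuit,
    (∃ t, FPTBounded A.κ t ∧ ComputesInTime (fun x => (C x).encode) t) ∧
    FPTBounded A.κ (fun x => (C x).size) ∧
    BoundedErrorDecides C A.lang}

end QParam

/-! The inclusions P ⊆ BQP and FPT ⊆ FPQT hold because the verdict of a decider can be rewritten as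
the description of a one-qubit circuit that accepts or rejects with certainty. If FPQT ⊆ FPT, then
BQP ⊆ P: under the constant parameterization the factor `f (κ x)` is a constant, so both kinds of
time bound are polynomial.

The substance is that BQP ⊆ P implies FPQT ⊆ FPT. Let `M` write the description of `C x` in exactly
`T x` steps, and consider words `x` padded by some number of blanks, a member being one with `x` in
the language and at least `T x` blanks. This padded language is in BQP: `M` is run with the blanks
as a clock, in time linear in the padded word, and an expired clock leaves the empty output, which
describes a rejecting circuit (`exists_computesInTime_clocked`). By hypothesis it is then in P. To
decide `x`, `M` is run once more, emitting one blank per step, and the polynomial-time decider is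
applied to the result (`ComputesInTime.pad`). The run itself measures the padding, so the bound `f
(κ x) * p |x|` is never evaluated. The total time is polynomial in `T x + |x|`, hence again an FPT
bound (`FPTBounded.eval`).

The rest is machine construction with exact step counts: a machine is embedded in a larger one so
that each of its steps becomes one step there. -/

namespace QParam

open Turing

/-! ### Counted runs of a transition system -/

/-- The transition system `f` leads from `a` to `b` in exactly `n` steps. -/
def RunsTo {α : Type*} (f : α → Option α) (n : ℕ) (a b : α) : Prop :=
  (flip bind f)^[n] (some a) = some b

namespace RunsTo

variable {α : Type*} {f : α → Option α} {a b c : α} {m n : ℕ}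

theorem refl (f : α → Option α) (a : α) : RunsTo f 0 a a := rfl

theorem eq_of_zero (h : RunsTo f 0 a b) : a = b := Option.some.inj h

theorem head (h : f a = some b) (h' : RunsTo f n b c) : RunsTo f (n + 1) a c := by
  have : flip bind f (some a) = some b := h
  rw [RunsTo, Function.iterate_succ_apply, this]
  exact h'

theorem single (h : f a = some b) : RunsTo f 1 a b := head h (refl f b)

theorem trans (h : RunsTo f m a b) (h' : RunsTo f n b c) : RunsTo f (m + n) a c := by
  rw [RunsTo, Nat.add_comm, Function.iterate_add_apply, h]
  exact h'

theorem iterate_none (f : α → Option α) (n : ℕ) : (flip bind f)^[n] none = none := by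
  induction n with
  | zero => rfl
  | succ n ih => rw [Function.iterate_succ_apply]; exact ih

theorem exists_split (h : RunsTo f (m + n) a c) : ∃ b, RunsTo f m a b ∧ RunsTo f n b c := by
  rw [RunsTo, Nat.add_comm, Function.iterate_add_apply] at h
  cases hb : (flip bind f)^[m] (some a) with
  | none => rw [hb, iterate_none] at h; cases h
  | some b => exact ⟨b, hb, by rw [hb] at h; exact h⟩

theorem of_succ (h : RunsTo f (n + 1) a c) : ∃ b, f a = some b ∧ RunsTo f n b c := by
  rw [Nat.add_comm] at h
  obtain ⟨b, hb, hc⟩ := exists_split h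
  exact ⟨b, hb, hc⟩

end RunsTo

/-! ### Statements of multi-stack machines -/

section Statements

variable {K : Type} [DecidableEq K] {Γ : K → Type} {Λ σ : Type}

/-- Push the symbol selected by `f`, if there is one. -/
noncomputable def pushOption (k : K) (f : σ → Option (Γ k)) (q : TM2.Stmt Γ Λ σ) :
    TM2.Stmt Γ Λ σ :=
  open Classical in
  if h : Nonempty (Γ k) then
    .branch (fun s => (f s).isSome) (.push k (fun s => (f s).getD (Classical.choice h)) q) q
  else q

/-- The default symbol is never pushed, since the branch guards it; if `Γ k` is empty, `f v` can
only be `none`. -/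
theorem stepAux_pushOption (k : K) (f : σ → Option (Γ k)) (q : TM2.Stmt Γ Λ σ) (v : σ)
    (S : ∀ k, List (Γ k)) :
    TM2.stepAux (pushOption k f q) v S =
      TM2.stepAux q v (Function.update S k ((f v).toList ++ S k)) := by
  unfold pushOption
  split_ifs with h
  · cases hf : f v <;> simp [hf]
  · cases hf : f v with
    | none => simp
    | some a => exact absurd ⟨a⟩ h

/-- Pop all the stacks in the list `ks`; the state is updated by `g` whenever a stack was not
empty. -/
def popAll (g : σ → σ) (q : TM2.Stmt Γ Λ σ) : List K → TM2.Stmt Γ Λ σ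
  | [] => q
  | k :: ks => .pop k (fun s a => if a.isSome then g s else s) (popAll g q ks)

/-- Idempotence lets `g` act as the raising of a flag: the final state tells whether some stack was
nonempty, however many were. -/
theorem stepAux_popAll {g : σ → σ} (hg : ∀ s, g (g s) = g s) (q : TM2.Stmt Γ Λ σ) :
    ∀ (ks : List K), ks.Nodup → ∀ (v : σ) (S : ∀ k, List (Γ k)),
    ∃ S' : ∀ k, List (Γ k), (∀ k ∈ ks, S' k = (S k).tail) ∧ (∀ k ∉ ks, S' k = S k) ∧
      (((∀ k ∈ ks, S k = []) ∧ TM2.stepAux (popAll g q ks) v S = TM2.stepAux q v S') ∨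
        ((∃ k ∈ ks, S k ≠ []) ∧ TM2.stepAux (popAll g q ks) v S = TM2.stepAux q (g v) S'))
  | [], _, v, S => ⟨S, by simp, by simp, Or.inl ⟨by simp, rfl⟩⟩
  | k :: ks, hks, v, S => by
    rw [List.nodup_cons] at hks
    obtain ⟨S', h1, h2, h3⟩ := stepAux_popAll hg q ks hks.2
      (if (S k).head?.isSome then g v else v) (Function.update S k (S k).tail)
    have hne : ∀ j ∈ ks, j ≠ k := fun j hj h => hks.1 (h ▸ hj)
    refine ⟨S', ?_, ?_, ?_⟩
    · intro j hj
      rcases List.mem_cons.1 hj with rfl | hj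
      · rw [h2 _ hks.1]; simp
      · rw [h1 j hj, Function.update_of_ne (hne j hj)]
    · intro j hj
      rw [List.mem_cons, not_or] at hj
      rw [h2 j hj.2, Function.update_of_ne hj.1]
    · rw [popAll, TM2.stepAux]
      cases hS : S k with
      | nil =>
        rw [hS] at h3
        rcases h3 with ⟨h3, h4⟩ | h3
        · refine Or.inl ⟨?_, by simpa using h4⟩
          intro j hj
          rcases List.mem_cons.1 hj with rfl | hj
          · exact hS
          · have := h3 j hj
            rwa [Function.update_of_ne (hne j hj)] at this
        · obtain ⟨⟨j, hj, hne'⟩, h3⟩ := h3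
          rw [Function.update_of_ne (hne j hj)] at hne'
          exact Or.inr ⟨⟨j, List.mem_cons_of_mem _ hj, hne'⟩, by simpa using h3⟩
      | cons a l =>
        refine Or.inr ⟨⟨k, List.mem_cons_self, by simp [hS]⟩, ?_⟩
        rw [hS] at h3
        rcases h3 with ⟨-, h3⟩ | ⟨-, h3⟩
        · simpa using h3
        · simpa [hg] using h3

/-- The largest number of symbols that a statement can push. -/
def pushCount : TM2.Stmt Γ Λ σ → ℕ
  | .push _ _ q => pushCount q + 1
  | .peek _ _ q => pushCount q
  | .pop _ _ q => pushCount q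
  | .load _ q => pushCount q
  | .branch _ q₁ q₂ => pushCount q₁ + pushCount q₂
  | .goto _ => 0
  | .halt => 0

/-- One machine step executes a whole statement and may push several symbols. `pushCount` adds up
both branches, a crude bound that suffices. -/
theorem length_stk_stepAux (k : K) (q : TM2.Stmt Γ Λ σ) : ∀ (v : σ) (S : ∀ k, List (Γ k)),
    ((TM2.stepAux q v S).stk k).length ≤ (S k).length + pushCount q := by
  induction q with
  | push j f q ih =>
    intro v S
    refine (ih _ _).trans ?_
    simp only [pushCount]
    rcases eq_or_ne k j with rfl | h
    · simp; omega
    · rw [Function.update_of_ne h]; omega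
  | pop j f q ih =>
    intro v S
    refine (ih _ _).trans ?_
    simp only [pushCount]
    rcases eq_or_ne k j with rfl | h
    · simp
    · rw [Function.update_of_ne h]
  | peek j f q ih => exact fun v S => ih _ _
  | load f q ih => exact fun v S => ih _ _
  | branch f q₁ q₂ ih₁ ih₂ =>
    intro v S
    simp only [TM2.stepAux, pushCount]
    cases f v
    · exact (ih₂ v S).trans (by omega)
    · exact (ih₁ v S).trans (by omega)
  | goto f => intro v S; simp [pushCount]
  | halt => intro v S; simp [pushCount]

/-- Finitely many labels give a uniform bound on the growth per step. It limits both the length of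
an output and the time needed to clear the stacks of an interrupted run. -/
theorem exists_stack_growth [Finite Λ] (m : Λ → TM2.Stmt Γ Λ σ) :
    ∃ d : ℕ, ∀ n (c c' : TM2.Cfg Γ Λ σ), RunsTo (TM2.step m) n c c' →
      ∀ k, (c'.stk k).length ≤ (c.stk k).length + d * n := by
  obtain ⟨d, hd⟩ := (Set.finite_range fun l => pushCount (m l)).bddAbove
  refine ⟨d, fun n => ?_⟩
  induction n with
  | zero => intro c c' h k; rw [h.eq_of_zero]; simp
  | succ n ih =>
    intro c c' h k
    obtain ⟨b, hb, hbc⟩ := h.of_succ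
    refine (ih b c' hbc k).trans ?_
    obtain ⟨_ | l, v, S⟩ := c
    · cases hb
    · obtain rfl := Option.some.inj hb
      have h1 := length_stk_stepAux k (m l) v S
      have h2 : pushCount (m l) ≤ d := hd ⟨l, rfl⟩
      rw [Nat.mul_succ]
      simp only at *
      omega

end Statements

/-! ### Running a machine as a subroutine of another one -/

/-- The data needed to run a machine with stacks `Γ`, labels `Λ` and states `σ` inside one with
stacks `Γ'`, labels `Λ'` and states `σ'`. -/
structure Subroutine {K K' : Type} (Γ : K → Type) (Λ σ : Type) (Γ' : K' → Type) (Λ' σ' : Type) where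
  stack : K → K'
  stack_injective : Function.Injective stack
  symbol : ∀ k, Γ k ≃ Γ' (stack k)
  label : Λ → Λ'
  exit : Λ'
  get : σ' → σ
  set : σ → σ' → σ'
  get_set : ∀ s s', get (set s s') = s

namespace Subroutine

variable {K K' : Type} {Γ : K → Type} {Λ σ : Type} {Γ' : K' → Type} {Λ' σ' : Type}
  (E : Subroutine Γ Λ σ Γ' Λ' σ')

/-- The statement of the ambient machine that corresponds to a statement of the subroutine. -/
def translate : TM2.Stmt Γ Λ σ → TM2.Stmt Γ' Λ' σ'
  | .push k f q => .push (E.stack k) (fun s => E.symbol k (f (E.get s))) (translate q)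
  | .peek k f q =>
    .peek (E.stack k) (fun s a => E.set (f (E.get s) (a.map (E.symbol k).symm)) s) (translate q)
  | .pop k f q =>
    .pop (E.stack k) (fun s a => E.set (f (E.get s) (a.map (E.symbol k).symm)) s) (translate q)
  | .load f q => .load (fun s => E.set (f (E.get s)) s) (translate q)
  | .branch f q₁ q₂ => .branch (fun s => f (E.get s)) (translate q₁) (translate q₂)
  | .goto f => .goto fun s => E.label (f (E.get s))
  | .halt => .goto fun _ => E.exit

/-- The configuration `c'` of the ambient machine represents the configuration `c`. -/
structure Represents (c : TM2.Cfg Γ Λ σ) (c' : TM2.Cfg Γ' Λ' σ') : Prop where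
  label_eq : c'.l = some (c.l.elim E.exit E.label)
  get_var : E.get c'.var = c.var
  stk_eq : ∀ k, c'.stk (E.stack k) = (c.stk k).map (E.symbol k)

variable [DecidableEq K] [DecidableEq K']

/-- Structural induction. Halting becomes a jump to `exit`, so control returns to the ambient
machine; the second conjunct leaves the foreign stacks free for a clock or for padding. -/
theorem stepAux_translate (q : TM2.Stmt Γ Λ σ) :
    ∀ (v : σ) (S : ∀ k, List (Γ k)) (v' : σ') (S' : ∀ k, List (Γ' k)), E.get v' = v →
      (∀ k, S' (E.stack k) = (S k).map (E.symbol k)) →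
      E.Represents (TM2.stepAux q v S) (TM2.stepAux (E.translate q) v' S') ∧
        ∀ j ∉ Set.range E.stack, (TM2.stepAux (E.translate q) v' S').stk j = S' j := by
  have key : ∀ (k : K) (S : ∀ k, List (Γ k)) (S' : ∀ k, List (Γ' k)) (l : List (Γ k)),
      (∀ k, S' (E.stack k) = (S k).map (E.symbol k)) →
      ∀ j, Function.update S' (E.stack k) (l.map (E.symbol k)) (E.stack j) =
        (Function.update S k l j).map (E.symbol j) := by
    intro k S S' l h j
    rcases eq_or_ne j k with rfl | hj
    · simp
    · rw [Function.update_of_ne hj, Function.update_of_ne (E.stack_injective.ne hj), h]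
  have frame : ∀ (k : K) (S' : ∀ k, List (Γ' k)) (l : List (Γ' (E.stack k))),
      ∀ j ∉ Set.range E.stack, Function.update S' (E.stack k) l j = S' j := by
    intro k S' l j hj
    exact Function.update_of_ne (fun h => hj ⟨k, h.symm⟩) _ _
  have head : ∀ (k : K) (S : ∀ k, List (Γ k)) (S' : ∀ k, List (Γ' k)),
      (∀ k, S' (E.stack k) = (S k).map (E.symbol k)) →
      (S' (E.stack k)).head?.map (E.symbol k).symm = (S k).head? := by
    intro k S S' h
    rw [h]
    cases S k <;> simp
  induction q with
  | push k f q ih =>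
    intro v S v' S' hv hS
    subst hv
    have h := key k S S' (f (E.get v') :: S k) hS
    rw [List.map_cons, ← hS k] at h
    obtain ⟨h1, h2⟩ := ih (E.get v') _ v' _ rfl h
    exact ⟨h1, fun j hj => (h2 j hj).trans (frame k S' _ j hj)⟩
  | pop k f q ih =>
    intro v S v' S' hv hS
    subst hv
    have h := key k S S' (S k).tail hS
    rw [List.map_tail, ← hS k] at h
    obtain ⟨h1, h2⟩ := ih _ _ _ _ (E.get_set _ v') h
    simp only [translate, TM2.stepAux, head k S S' hS]
    exact ⟨h1, fun j hj => (h2 j hj).trans (frame k S' _ j hj)⟩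
  | peek k f q ih =>
    intro v S v' S' hv hS
    subst hv
    simp only [translate, TM2.stepAux, head k S S' hS]
    exact ih _ _ _ _ (E.get_set _ v') hS
  | load f q ih =>
    intro v S v' S' hv hS
    subst hv
    exact ih _ _ _ _ (E.get_set _ v') hS
  | branch f q₁ q₂ ih₁ ih₂ =>
    intro v S v' S' hv hS
    subst hv
    simp only [translate, TM2.stepAux]
    cases f (E.get v')
    · exact ih₂ _ _ _ _ rfl hS
    · exact ih₁ _ _ _ _ rfl hS
  | goto f =>
    intro v S v' S' hv hS
    subst hv
    exact ⟨⟨rfl, rfl, hS⟩, fun _ _ => rfl⟩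
  | halt => exact fun v S v' S' hv hS => ⟨⟨rfl, hv, hS⟩, fun _ _ => rfl⟩

/-- If the ambient machine simulates each step of the subroutine by one of its own, while the
invariant `P` evolves, then it simulates runs. -/
theorem runsTo {m : Λ → TM2.Stmt Γ Λ σ} {m' : Λ' → TM2.Stmt Γ' Λ' σ'}
    (P : ℕ → (∀ k, List (Γ' k)) → Prop)
    (step : ∀ i l v S v' S', E.get v' = v → (∀ k, S' (E.stack k) = (S k).map (E.symbol k)) →
      P (i + 1) S' → E.Represents (TM2.stepAux (m l) v S) (TM2.stepAux (m' (E.label l)) v' S') ∧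
        P i (TM2.stepAux (m' (E.label l)) v' S').stk) {i : ℕ} :
    ∀ {n : ℕ} {c d : TM2.Cfg Γ Λ σ} {c' : TM2.Cfg Γ' Λ' σ'}, RunsTo (TM2.step m) n c d →
      E.Represents c c' → P (n + i) c'.stk →
      ∃ d', RunsTo (TM2.step m') n c' d' ∧ E.Represents d d' ∧ P i d'.stk := by
  -- The index of `P` counts down: `n + i` before the run and `i` after it, like ticks left on a
  -- clock.
  intro n
  induction n with
  | zero =>
    intro c d c' h hc hP
    obtain rfl := h.eq_of_zero
    exact ⟨c', RunsTo.refl _ _, hc, by simpa using hP⟩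
  | succ n ih =>
    intro c d c' h hc hP
    obtain ⟨b, hb, hbd⟩ := h.of_succ
    obtain ⟨_ | l, v, S⟩ := c
    · cases hb
    obtain rfl := Option.some.inj hb
    obtain ⟨l', v', S'⟩ := c'
    obtain ⟨h1, h2, h3⟩ := hc
    obtain rfl : l' = some (E.label l) := h1
    obtain ⟨h4, h5⟩ := step (n + i) l v S v' S' h2 h3 (by rwa [Nat.add_right_comm] at hP)
    obtain ⟨d', hd, hd'⟩ := ih hbd h4 h5
    exact ⟨d', RunsTo.head rfl hd, hd'⟩

end Subroutine

/-! ### Bundled machines -/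

theorem initList_eq (M : FinTM2) (s : List (M.Γ M.k₀)) :
    initList M s = ⟨some M.main, M.initialState, Function.update (fun _ => []) M.k₀ s⟩ := by
  unfold initList
  congr 1
  funext k
  rcases eq_or_ne k M.k₀ with rfl | h
  · simp
  · simp [h]

/-- A halting configuration must have the initial state and no stack but the output nonempty. This
is why every program below cleans up before halting. -/
theorem haltList_eq (M : FinTM2) (s : List (M.Γ M.k₁)) :
    haltList M s = ⟨none, M.initialState, Function.update (fun _ => []) M.k₁ s⟩ := by
  unfold haltList
  congr 1
  funext k
  rcases eq_or_ne k M.k₁ with rfl | h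
  · simp
  · simp [h]

/-- The machine `M` turns the input `s` into the output `r` in exactly `n` steps. -/
def Outputs (M : FinTM2) (n : ℕ) (s : List (M.Γ M.k₀)) (r : List (M.Γ M.k₁)) : Prop :=
  RunsTo (TM2.step M.m) n ⟨some M.main, M.initialState, Function.update (fun _ => []) M.k₀ s⟩
    ⟨none, M.initialState, Function.update (fun _ => []) M.k₁ r⟩

theorem nonempty_outputsInTime_iff (M : FinTM2) (s : List (M.Γ M.k₀)) (r : List (M.Γ M.k₁))
    (t : ℕ) : Nonempty (TM2OutputsInTime M s (some r) t) ↔ ∃ n ≤ t, Outputs M n s r := by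
  constructor
  · rintro ⟨⟨⟨n, h⟩, hn⟩⟩
    refine ⟨n, hn, ?_⟩
    rw [initList_eq, Option.map_some, haltList_eq] at h
    exact h
  · rintro ⟨n, hn, h⟩
    refine ⟨⟨⟨n, ?_⟩, hn⟩⟩
    rw [initList_eq, Option.map_some, haltList_eq]
    exact h

/-! ### Loops that move the contents of a stack -/

section MoveLoop

variable {K : Type} [DecidableEq K] {Γ : K → Type} {Λ σ : Type}

/-- Pop a symbol of the stack `src`, push the symbols determined by it on the stacks `a` and `b`,
and return to the label `L`; when `src` is empty, go on with `q`. -/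
noncomputable def moveLoop (L : Λ) (src : K) (f : σ → Option (Γ src) → σ) (p : σ → Bool)
    (a : K) (g : σ → Option (Γ a)) (b : K) (h : σ → Option (Γ b)) (q : TM2.Stmt Γ Λ σ) :
    TM2.Stmt Γ Λ σ :=
  .pop src f (pushOption a g (pushOption b h (.branch p (.goto fun _ => L) q)))

/-- One round per symbol, and one more that finds the stack empty and executes `q` within the same
step. The state carries the popped symbol from `f` to `g` and `h`; moving between stacks reverses
the word. -/
theorem runsTo_moveLoop {m : Λ → TM2.Stmt Γ Λ σ} {L : Λ} {src : K} {f : σ → Option (Γ src) → σ}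
    {p : σ → Bool} {a : K} {g : σ → Option (Γ a)} {b : K} {h : σ → Option (Γ b)}
    {q : TM2.Stmt Γ Λ σ} (hm : m L = moveLoop L src f p a g b h q)
    (ha : a ≠ src) (hb : b ≠ src) (hab : b ≠ a) (hp : ∀ s x, p (f s x) = x.isSome)
    (G : Γ src → Option (Γ a)) (hg : ∀ s x, g (f s x) = x.bind G)
    (H : Γ src → Option (Γ b)) (hh : ∀ s x, h (f s x) = x.bind H) :
    ∀ (l : List (Γ src)) (v : σ) (S : ∀ k, List (Γ k)), S src = l →
    ∃ v' S', RunsTo (TM2.step m) (l.length + 1) ⟨some L, v, S⟩ (TM2.stepAux q v' S') ∧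
      S' src = [] ∧ S' a = (l.filterMap G).reverse ++ S a ∧
      S' b = (l.filterMap H).reverse ++ S b ∧
      ∀ j, j ≠ src → j ≠ a → j ≠ b → S' j = S j
  | [], v, S, hS => by
    refine ⟨f v none, S, RunsTo.single ?_, hS, by simp, by simp, fun _ _ _ _ => rfl⟩
    rw [TM2.step, hm, moveLoop, TM2.stepAux, stepAux_pushOption, stepAux_pushOption]
    simp [hS, hg, hh, hp]
    congr 1
    rw [show ([] : List (Γ src)) = S src from hS.symm, Function.update_eq_self]
  | x :: l, v, S, hS => by
    obtain ⟨v', S', h1, h2, h3, h4, h5⟩ := runsTo_moveLoop hm ha hb hab hp G hg H hh l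
      (f v (some x)) (Function.update (Function.update (Function.update S src l)
        a ((G x).toList ++ S a)) b ((H x).toList ++ S b))
      (by simp [ha.symm, hb.symm])
    refine ⟨v', S', RunsTo.head ?_ h1, h2, ?_, ?_, ?_⟩
    · rw [TM2.step, hm, moveLoop, TM2.stepAux, stepAux_pushOption, stepAux_pushOption]
      simp [hS, hg, hh, hp, ha, hb, hab]
    · rw [h3]
      cases hx : G x <;> simp [hx, hab.symm]
    · rw [h4]
      cases hx : H x <;> simp [hx]
    · intro j j1 j2 j3
      rw [h5 j j1 j2 j3]
      simp [j1, j2, j3]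

end MoveLoop

/-! ### Programs built around subroutines -/

section Programs

variable {K K' : Type} [DecidableEq K] [DecidableEq K'] {Γ : K → Type} {Λ σ : Type}
  {Γ' : K' → Type} {Λ' σ' : Type} (E : Subroutine Γ Λ σ Γ' Λ' σ')
  {m : Λ → TM2.Stmt Γ Λ σ} {m' : Λ' → TM2.Stmt Γ' Λ' σ'}

theorem map_update_nil (k₀ : K) (s : List (Γ k₀)) (k : K) :
    (Function.update (fun _ => []) (E.stack k₀) (s.map (E.symbol k₀)) : ∀ k, List (Γ' k))
        (E.stack k) =
      ((Function.update (fun _ => []) k₀ s : ∀ k, List (Γ k)) k).map (E.symbol k) := by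
  rcases eq_or_ne k k₀ with rfl | hk
  · simp
  · simp [hk, E.stack_injective.ne hk]

/-- A program that runs a subroutine, reads one symbol of its output, and writes at most one
symbol in response. -/
theorem runsTo_rewriteOutput {main : Λ} {k₀ k₁ : K} {v₀ : σ} {out : K'} {w₀ : σ'}
    {f : σ' → Option (Γ' (E.stack k₁)) → σ'} {g : σ' → Option (Γ' out)}
    (label : ∀ l, m' (E.label l) = E.translate (m l))
    (exit : m' E.exit = .pop (E.stack k₁) f (pushOption out g (.load (fun _ => w₀) .halt)))
    (cover : ∀ j, j ∈ Set.range E.stack ∨ j = out) (hout : out ∉ Set.range E.stack)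
    (get : E.get w₀ = v₀) {n : ℕ} {s : List (Γ k₀)} {r : Γ k₁} {o : Option (Γ' out)}
    (hg : ∀ v, g (f v (some (E.symbol k₁ r))) = o)
    (h : RunsTo (TM2.step m) n ⟨some main, v₀, Function.update (fun _ => []) k₀ s⟩
      ⟨none, v₀, Function.update (fun _ => []) k₁ [r]⟩) :
    RunsTo (TM2.step m') (n + 1)
      ⟨some (E.label main), w₀, Function.update (fun _ => []) (E.stack k₀) (s.map (E.symbol k₀))⟩
      ⟨none, w₀, Function.update (fun _ => []) out o.toList⟩ := by
  have ne : ∀ k, out ≠ E.stack k := fun k hk => hout ⟨k, hk.symm⟩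
  obtain ⟨⟨l', v', S'⟩, h1, ⟨h2, h3, h4⟩, h5⟩ := E.runsTo (m' := m')
    (fun _ S' => S' out = [])
    (fun i l v S v' S' hv hS hP => by
      obtain ⟨h1, h2⟩ := E.stepAux_translate (m l) v S v' S' hv hS
      rw [label]
      exact ⟨h1, (h2 out hout).trans hP⟩) (i := 0) h
    (c' := ⟨some (E.label main), w₀, Function.update (fun _ => []) (E.stack k₀)
      (s.map (E.symbol k₀))⟩)
    ⟨rfl, get, map_update_nil E k₀ s⟩ (by simp [ne])
  obtain rfl : l' = some E.exit := h2
  refine h1.trans (RunsTo.single ?_)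
  have hk : S' (E.stack k₁) = [E.symbol k₁ r] := by simpa using h4 k₁
  replace h5 : S' out = [] := h5
  rw [TM2.step, exit, TM2.stepAux, stepAux_pushOption]
  simp only [TM2.stepAux, hk, List.head?_cons, hg]
  congr 2
  funext j
  rcases cover j with ⟨k, rfl⟩ | rfl
  · rcases eq_or_ne k k₁ with rfl | hk'
    · simp [(ne _).symm]
    · have := h4 k
      simp only [Function.update_of_ne hk', List.map_nil] at this
      simp [(ne _).symm, E.stack_injective.ne hk', this]
  · simp [ne, h5]

/-- The loop that empties the stacks `ks`. -/
theorem runsTo_abort {L : Λ'} {p : σ' → Bool} {c g : σ' → σ'} {w₀ : σ'} {ks : List K'}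
    (hm : m' L = .load c (popAll g (.branch p (.goto fun _ => L) (.load (fun _ => w₀) .halt)) ks))
    (hks : ks.Nodup) (hc : ∀ s, p (c s) = false) (hg : ∀ s, p (g s) = true)
    (hgg : ∀ s, g (g s) = g s) :
    ∀ (N : ℕ) (v : σ') (S : ∀ k, List (Γ' k)), (∀ j ∉ ks, S j = []) →
      (∀ j, (S j).length ≤ N) →
      ∃ n ≤ N + 1, RunsTo (TM2.step m') n ⟨some L, v, S⟩ ⟨none, w₀, fun _ => []⟩ := by
  -- Each round pops all the stacks at once, so `N` bounds the number of rounds by the greatest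
  -- height; the extra step detects emptiness.
  intro N
  induction N with
  | zero =>
    intro v S _ hN
    have hS : S = fun _ => [] := by
      funext j
      exact List.length_eq_zero_iff.1 (Nat.le_zero.1 (hN j))
    subst hS
    obtain ⟨S', h1, h2, ⟨-, h3⟩ | ⟨⟨k, -, hk⟩, -⟩⟩ := stepAux_popAll hgg
      (.branch p (.goto fun _ => L) (.load (fun _ => w₀) .halt)) ks hks (c v) (fun _ => [])
    · obtain rfl : S' = fun _ => [] := by
        funext j
        by_cases hj : j ∈ ks
        · exact h1 j hj
        · exact h2 j hj
      refine ⟨1, le_rfl, RunsTo.single ?_⟩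
      rw [TM2.step, hm, TM2.stepAux, h3]
      simp [hc]
    · exact absurd rfl hk
  | succ N ih =>
    intro v S hks' hN
    obtain ⟨S', h1, h2, h3⟩ := stepAux_popAll hgg
      (.branch p (.goto fun _ => L) (.load (fun _ => w₀) .halt)) ks hks (c v) S
    rcases h3 with ⟨h4, h3⟩ | ⟨-, h3⟩
    · obtain rfl : S' = fun _ => [] := by
        funext j
        by_cases hj : j ∈ ks
        · rw [h1 j hj, h4 j hj]; rfl
        · rw [h2 j hj, hks' j hj]
      refine ⟨1, by omega, RunsTo.single ?_⟩
      rw [TM2.step, hm, TM2.stepAux, h3]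
      simp [hc]
    · obtain ⟨n, hn, hrun⟩ := ih (g (c v)) S' (fun j hj => (h2 j hj).trans (hks' j hj)) (fun j => by
        by_cases hj : j ∈ ks
        · have := hN j
          rw [h1 j hj, List.length_tail]; omega
        · rw [h2 j hj, hks' j hj]; exact Nat.zero_le _)
      refine ⟨n + 1, by omega, RunsTo.head ?_ hrun⟩
      rw [TM2.step, hm, TM2.stepAux, h3]
      simp [hg]

end Programs

/-! ### Constant output, and padding as a clock -/

section Programs

variable {K K' : Type} [DecidableEq K] [DecidableEq K'] {Γ : K → Type} {Λ σ : Type}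
  {Γ' : K' → Type} {Λ' σ' : Type} (E : Subroutine Γ Λ σ Γ' Λ' σ')
  {m : Λ → TM2.Stmt Γ Λ σ} {m' : Λ' → TM2.Stmt Γ' Λ' σ'}

/-- A program that erases its input and writes one symbol. -/
theorem runsTo_singleton {L : Λ'} {src out aux : K'} {w₀ : σ'} {f : σ' → Option (Γ' src) → σ'}
    {p : σ' → Bool} {c : Γ' out}
    (hm : m' L = moveLoop L src f p out (fun _ => none) aux (fun _ => none)
      (.push out (fun _ => c) (.load (fun _ => w₀) .halt)))
    (hp : ∀ s x, p (f s x) = x.isSome) (ho : out ≠ src) (ha : aux ≠ src) (hao : aux ≠ out)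
    (cover : ∀ j, j = src ∨ j = out ∨ j = aux) (x : List (Γ' src)) :
    RunsTo (TM2.step m') (x.length + 1) ⟨some L, w₀, Function.update (fun _ => []) src x⟩
      ⟨none, w₀, Function.update (fun _ => []) out [c]⟩ := by
  obtain ⟨v, S, run, src', out', aux', -⟩ := runsTo_moveLoop hm ho ha hao hp (fun _ => none)
    (fun _ x => by cases x <;> rfl) (fun _ => none) (fun _ x => by cases x <;> rfl) x w₀
    (Function.update (fun _ => []) src x) (by simp)
  simp only [TM2.stepAux] at run
  convert run using 2
  funext j
  rcases cover j with rfl | rfl | rfl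
  · simp [ho.symm, src']
  · simp [out', ho]
  · simp [aux', ha, hao]

/-- The word hidden in a padded word, written there backwards. -/
def unpad {α : Type} (l : List (Option α)) : List α := l.reduceOption.reverse

/-- The amount of padding in a padded word. -/
def padding {α : Type} (l : List (Option α)) : ℕ := l.countP Option.isNone

theorem length_unpad_le {α : Type} (l : List (Option α)) : (unpad l).length ≤ l.length := by
  rw [unpad, List.length_reverse]
  exact List.reduceOption_length_le l

theorem padding_le {α : Type} (l : List (Option α)) : padding l ≤ l.length :=
  List.countP_le_length

/-- A program that reads a padded word, and runs a subroutine on the word hidden in it for as many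
steps as there is padding. -/
theorem exists_runsTo_clocked {main : Λ} {k₀ k₁ : K} {v₀ : σ} {inp cnt : K'} {w₀ : σ'}
    {readLabel abortLabel : Λ'} {ι : Γ' inp → Option (Γ k₀)} {tick : Γ' cnt}
    {f : σ' → Option (Γ' inp) → σ'} {p : σ' → Bool} {g : σ' → Option (Γ' cnt)}
    {h : σ' → Option (Γ' (E.stack k₀))} {flag : σ' → Option (Γ' cnt) → σ'} {isSet : σ' → Bool}
    {clear raise : σ' → σ'} {ks : List K'}
    (read : m' readLabel = moveLoop readLabel inp f p cnt g (E.stack k₀) h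
      (.load (fun _ => w₀) (.goto fun _ => E.label main)))
    (label : ∀ l, m' (E.label l) =
      .pop cnt flag (.branch isSet (E.translate (m l)) (.goto fun _ => abortLabel)))
    (exit : m' E.exit = moveLoop E.exit cnt flag isSet inp (fun _ => none) (E.stack k₀)
      (fun _ => none) (.load (fun _ => w₀) .halt))
    (abort : m' abortLabel = .load clear
      (popAll raise (.branch isSet (.goto fun _ => abortLabel) (.load (fun _ => w₀) .halt)) ks))
    (hp : ∀ s x, p (f s x) = x.isSome)
    (hg : ∀ s x, g (f s x) = x.bind fun y => (ι y).elim (some tick) fun _ => none)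
    (hh : ∀ s x, h (f s x) = x.bind fun y => (ι y).map (E.symbol k₀))
    (isSet_flag : ∀ s x, isSet (flag s x) = x.isSome) (get_flag : ∀ s x, E.get (flag s x) = E.get s)
    (isSet_clear : ∀ s, isSet (clear s) = false) (isSet_raise : ∀ s, isSet (raise s) = true)
    (raise_raise : ∀ s, raise (raise s) = raise s)
    (cover : ∀ j, j ∈ Set.range E.stack ∨ j = inp ∨ j = cnt)
    (hinp : inp ∉ Set.range E.stack) (hcnt : cnt ∉ Set.range E.stack) (hic : inp ≠ cnt)
    (ks_nodup : ks.Nodup) (mem_ks : ∀ k, E.stack k ∈ ks) (get : E.get w₀ = v₀)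
    {w : List (Γ' inp)} {n d : ℕ} {r : List (Γ k₁)}
    (hd : ∀ n (c c' : TM2.Cfg Γ Λ σ), RunsTo (TM2.step m) n c c' →
      ∀ k, (c'.stk k).length ≤ (c.stk k).length + d * n)
    (hrun : RunsTo (TM2.step m) n
      ⟨some main, v₀, Function.update (fun _ => []) k₀ (unpad (w.map ι))⟩
      ⟨none, v₀, Function.update (fun _ => []) k₁ r⟩) :
    ∃ N ≤ (d + 3) * w.length + 3,
      (n ≤ padding (w.map ι) → RunsTo (TM2.step m') N
        ⟨some readLabel, w₀, Function.update (fun _ => []) inp w⟩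
        ⟨none, w₀, Function.update (fun _ => []) (E.stack k₁) (r.map (E.symbol k₁))⟩) ∧
      (padding (w.map ι) < n → RunsTo (TM2.step m') N
        ⟨some readLabel, w₀, Function.update (fun _ => []) inp w⟩ ⟨none, w₀, fun _ => []⟩) := by
  have nei : ∀ k, E.stack k ≠ inp := fun k hk => hinp ⟨k, hk⟩
  have nec : ∀ k, E.stack k ≠ cnt := fun k hk => hcnt ⟨k, hk⟩
  -- Blanks become ticks on `cnt`, letters go to the input stack of the subroutine. The reversal
  -- undoes the backward spelling of the hidden word.
  obtain ⟨v₁, S₁, run₁, inp₁, cnt₁, stack₁, other₁⟩ := runsTo_moveLoop read hic.symm (nei k₀)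
    (nec k₀) hp _ hg _ hh w w₀ (Function.update (fun _ => []) inp w) (by simp)
  simp only [TM2.stepAux] at run₁
  have hlen : (S₁ cnt).length = padding (w.map ι) := by
    rw [cnt₁, Function.update_of_ne hic.symm, List.append_nil, List.length_reverse]
    clear * -
    induction w with
    | nil => rfl
    | cons y w ih =>
      rw [padding] at ih
      rw [List.map_cons, padding, List.countP_cons, ← ih, List.filterMap_cons]
      cases ι y <;> simp
  have hrep : ∀ k, S₁ (E.stack k) =
      ((Function.update (fun _ => []) k₀ (unpad (w.map ι)) : ∀ k, List (Γ k)) k).map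
        (E.symbol k) := by
    intro k
    rcases eq_or_ne k k₀ with rfl | hk
    · rw [stack₁, Function.update_of_ne (nei k), List.append_nil, Function.update_self, unpad,
        List.map_reverse, List.reduceOption, List.filterMap_map, List.map_filterMap]
      rfl
    · rw [other₁ _ (nei k) (nec k) (E.stack_injective.ne hk)]
      simp [hk, nei]
  set t := padding (w.map ι) with ht
  have htw : t ≤ w.length := by simpa using padding_le (w.map ι)
  have step : ∀ i l v S v' S', E.get v' = v → (∀ k, S' (E.stack k) = (S k).map (E.symbol k)) →
      (S' inp = [] ∧ (S' cnt).length = i + 1) →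
      E.Represents (TM2.stepAux (m l) v S) (TM2.stepAux (m' (E.label l)) v' S') ∧
        ((TM2.stepAux (m' (E.label l)) v' S').stk inp = [] ∧
          ((TM2.stepAux (m' (E.label l)) v' S').stk cnt).length = i) := by
    rintro i l v S v' S' hv hS ⟨hi, hc⟩
    obtain ⟨a, rest, hcons⟩ : ∃ a rest, S' cnt = a :: rest := by
      cases hS' : S' cnt with
      | nil => rw [hS'] at hc; cases hc
      | cons a rest => exact ⟨a, rest, rfl⟩
    obtain ⟨h1, h2⟩ := E.stepAux_translate (m l) v S (flag v' (some a))
      (Function.update S' cnt rest) ((get_flag _ _).trans hv)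
      (fun k => by rw [Function.update_of_ne (nec k), hS])
    rw [label, TM2.stepAux, TM2.stepAux, isSet_flag, hcons]
    refine ⟨h1, ?_, ?_⟩
    · exact (h2 inp hinp).trans (by rw [Function.update_of_ne hic, hi])
    · refine (congrArg List.length (h2 cnt hcnt)).trans ?_
      rw [hcons] at hc
      simpa using hc
  have rep₁ : E.Represents ⟨some main, v₀, Function.update (fun _ => []) k₀ (unpad (w.map ι))⟩
    ⟨some (E.label main), w₀, S₁⟩ := ⟨rfl, get, hrep⟩
  rcases le_or_gt n t with hn | hn
  · obtain ⟨⟨l₂, v₂, S₂⟩, run₂, ⟨h2, h3, h4⟩, inp₂, cnt₂⟩ := E.runsTo (m' := m')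
      (fun i S' => S' inp = [] ∧ (S' cnt).length = i) step (i := t - n) hrun rep₁
      ⟨inp₁, by simp only [hlen]; omega⟩
    obtain rfl : l₂ = some E.exit := h2
    replace inp₂ : S₂ inp = [] := inp₂
    replace cnt₂ : (S₂ cnt).length = t - n := cnt₂
    obtain ⟨v₃, S₃, run₃, cnt₃, inp₃, stack₃, other₃⟩ := runsTo_moveLoop exit hic (nec k₀)
      (nei k₀) isSet_flag (fun _ => none) (fun _ x => by cases x <;> rfl) (fun _ => none)
      (fun _ x => by cases x <;> rfl) (S₂ cnt) v₂ S₂ rfl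
    have hS₃ : S₃ = Function.update (fun _ => []) (E.stack k₁) (r.map (E.symbol k₁)) := by
      funext j
      rcases cover j with ⟨k, rfl⟩ | rfl | rfl
      · have : S₃ (E.stack k) = S₂ (E.stack k) := by
          rcases eq_or_ne k k₀ with rfl | hk
          · simpa using stack₃
          · exact other₃ _ (nec k) (nei k) (E.stack_injective.ne hk)
        rw [this, map_update_nil]
        exact h4 k
      · rw [Function.update_of_ne (nei k₁).symm, inp₃, inp₂]; simp
      · rw [Function.update_of_ne (nec k₁).symm, cnt₃]
    subst hS₃
    refine ⟨_, ?_, fun _ => run₁.trans (run₂.trans run₃), fun h => absurd hn h.not_ge⟩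
    rw [cnt₂]
    nlinarith [Nat.zero_le (d * w.length), Nat.sub_le t n]
  -- The clock expires after `t` steps. At least one step remains, so the subroutine has not yet
  -- halted and the next pop of `cnt` fails.
  · obtain ⟨⟨l, v, S⟩, hpre, hpost⟩ : ∃ b, RunsTo (TM2.step m) t _ b ∧
        RunsTo (TM2.step m) (n - t - 1 + 1) b _ :=
      RunsTo.exists_split (by rwa [show t + (n - t - 1 + 1) = n by omega])
    obtain ⟨b, hb, -⟩ := hpost.of_succ
    obtain ⟨⟨l₂, v₂, S₂⟩, run₂, ⟨h2, h3, h4⟩, inp₂, cnt₂⟩ := E.runsTo (m' := m')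
      (fun i S' => S' inp = [] ∧ (S' cnt).length = i) step (i := 0) hpre rep₁
      ⟨inp₁, hlen⟩
    replace inp₂ : S₂ inp = [] := inp₂
    replace cnt₂ : S₂ cnt = [] := List.length_eq_zero_iff.1 cnt₂
    cases l with
    | none => cases hb
    | some l =>
      obtain rfl : l₂ = some (E.label l) := h2
      obtain ⟨N, hN, run₄⟩ := runsTo_abort abort ks_nodup isSet_clear isSet_raise raise_raise
        ((d + 1) * w.length) (flag v₂ none) S₂
        (fun j hj => by
          rcases cover j with ⟨k, rfl⟩ | rfl | rfl
          · exact absurd (mem_ks k) hj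
          · exact inp₂
          · exact cnt₂)
        (fun j => by
          rcases cover j with ⟨k, rfl⟩ | rfl | rfl
          · have h5 := hd _ _ _ hpre k
            have h6 : ((Function.update (fun _ => []) k₀ (unpad (w.map ι)) :
                ∀ k, List (Γ k)) k).length ≤ w.length := by
              rcases eq_or_ne k k₀ with rfl | hk
              · simpa using length_unpad_le (w.map ι)
              · simp [hk]
            have h7 : (S₂ (E.stack k)).length = (S k).length := by
              have := congrArg List.length (h4 k)
              simpa using this
            have h8 := Nat.mul_le_mul_left d htw
            rw [h7]
            simp only at h5
            linarith
          · simp [inp₂]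
          · simp [cnt₂])
      have run₃ : RunsTo (TM2.step m') 1 ⟨some (E.label l), v₂, S₂⟩
          ⟨some abortLabel, flag v₂ none, S₂⟩ := by
        refine RunsTo.single ?_
        rw [TM2.step, label, TM2.stepAux, TM2.stepAux, isSet_flag, cnt₂]
        simp only [List.head?_nil, Option.isSome_none, cond_false, TM2.stepAux, List.tail_nil]
        rw [← cnt₂, Function.update_eq_self]
      refine ⟨_, ?_, fun h => absurd hn h.not_gt,
        fun _ => run₁.trans (run₂.trans (run₃.trans run₄))⟩
      -- Reading takes `|w| + 1` steps, simulation `t ≤ |w|`, the failed pop `1`, and clearing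
      -- stacks of height at most `|w| + d * t` at most `(d + 1) * |w| + 1`.
      linarith

/-- A program that runs a subroutine, counting its steps, and then another subroutine on the input
padded by that number. -/
theorem runsTo_padded {J : Type} [DecidableEq J] {Δ : J → Type} {Ω τ : Type}
    (D : Subroutine Δ Ω τ Γ' Λ' σ') {mD : Ω → TM2.Stmt Δ Ω τ}
    {main : Λ} {k₀ k₁ : K} {v₀ : σ} {mainD : Ω} {j₀ j₁ : J} {u₀ : τ}
    {aux : K'} {w₀ : σ'} {copyLabel restoreLabel : Λ'} {ψ : Option (Γ k₀) → Δ j₀}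
    {α : Γ k₀ ≃ Γ' aux} {p : σ' → Bool}
    {f₁ : σ' → Option (Γ' (E.stack k₀)) → σ'} {g₁ : σ' → Option (Γ' aux)}
    {h₁ : σ' → Option (Γ' (D.stack j₀))}
    {f₂ : σ' → Option (Γ' aux) → σ'} {g₂ : σ' → Option (Γ' (E.stack k₀))}
    {f₃ : σ' → Option (Γ' (E.stack k₁)) → σ'}
    (copy : m' copyLabel = moveLoop copyLabel (E.stack k₀) f₁ p aux g₁ (D.stack j₀) h₁
      (.load (fun _ => w₀) (.goto fun _ => restoreLabel)))
    (restore : m' restoreLabel = moveLoop restoreLabel aux f₂ p (E.stack k₀) g₂ (D.stack j₀)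
      (fun _ => none) (.load (fun _ => w₀) (.goto fun _ => E.label main)))
    (label : ∀ l, m' (E.label l) =
      .push (D.stack j₀) (fun _ => D.symbol j₀ (ψ none)) (E.translate (m l)))
    (exit : m' E.exit = moveLoop E.exit (E.stack k₁) f₃ p aux (fun _ => none) (D.stack j₀)
      (fun _ => none) (.load (fun _ => w₀) (.goto fun _ => D.label mainD)))
    (labelD : ∀ l, m' (D.label l) = D.translate (mD l))
    (exitD : m' D.exit = .load (fun _ => w₀) .halt)
    (hp₁ : ∀ s x, p (f₁ s x) = x.isSome) (hp₂ : ∀ s x, p (f₂ s x) = x.isSome)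
    (hp₃ : ∀ s x, p (f₃ s x) = x.isSome)
    (hg₁ : ∀ s x, g₁ (f₁ s x) = x.bind fun y => some (α ((E.symbol k₀).symm y)))
    (hh₁ : ∀ s x, h₁ (f₁ s x) = x.bind fun y =>
      some (D.symbol j₀ (ψ (some ((E.symbol k₀).symm y)))))
    (hg₂ : ∀ s x, g₂ (f₂ s x) = x.bind fun y => some (E.symbol k₀ (α.symm y)))
    (cover : ∀ j, j ∈ Set.range E.stack ∨ j ∈ Set.range D.stack ∨ j = aux)
    (disjoint : ∀ k j, E.stack k ≠ D.stack j)
    (hauxE : aux ∉ Set.range E.stack) (hauxD : aux ∉ Set.range D.stack)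
    (get : E.get w₀ = v₀) (getD : D.get w₀ = u₀)
    {x : List (Γ k₀)} {n nD : ℕ} {r : List (Γ k₁)} {y : List (Δ j₁)}
    (hrun : RunsTo (TM2.step m) n ⟨some main, v₀, Function.update (fun _ => []) k₀ x⟩
      ⟨none, v₀, Function.update (fun _ => []) k₁ r⟩)
    (hrunD : RunsTo (TM2.step mD) nD ⟨some mainD, u₀, Function.update (fun _ => []) j₀
        ((List.replicate n none ++ (x.map some).reverse).map ψ)⟩
      ⟨none, u₀, Function.update (fun _ => []) j₁ y⟩) :
    RunsTo (TM2.step m') ((x.length + 1) + ((x.length + 1) + (n + ((r.length + 1) + (nD + 1)))))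
      ⟨some copyLabel, w₀, Function.update (fun _ => []) (E.stack k₀) (x.map (E.symbol k₀))⟩
      ⟨none, w₀, Function.update (fun _ => []) (D.stack j₁) (y.map (D.symbol j₁))⟩ := by
  have nea : ∀ k, E.stack k ≠ aux := fun k hk => hauxE ⟨k, hk⟩
  have neda : ∀ k, D.stack k ≠ aux := fun k hk => hauxD ⟨k, hk⟩
  obtain ⟨v₁, S₁, run₁, src₁, aux₁, D₁, other₁⟩ := runsTo_moveLoop copy (nea k₀).symm
    (disjoint k₀ j₀).symm (neda j₀) hp₁ _ hg₁ _ hh₁ (x.map (E.symbol k₀)) w₀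
    (Function.update (fun _ => []) (E.stack k₀) (x.map (E.symbol k₀))) (by simp)
  -- Copying consumed the input; moving `aux` back restores it in its original order. The copy for
  -- `D` stays reversed, as padded words require.
  obtain ⟨v₂, S₂, run₂, aux₂, src₂, D₂, other₂⟩ := runsTo_moveLoop restore (nea k₀) (neda j₀)
    (disjoint k₀ j₀).symm hp₂ _ hg₂ (fun _ => none) (fun _ x => by cases x <;> rfl)
    (S₁ aux) w₀ S₁ rfl
  simp only [TM2.stepAux] at run₁ run₂
  have aux₁' : S₁ aux = x.reverse.map α := by
    rw [aux₁]
    simp [(nea k₀).symm, List.filterMap_map, List.filterMap_eq_map']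
  have D₂' : S₂ (D.stack j₀) = ((x.map some).reverse.map ψ).map (D.symbol j₀) := by
    rw [D₂, D₁]
    simp [(disjoint k₀ j₀).symm, List.filterMap_map, Function.comp_def, List.filterMap_eq_map']
  have src₂' : S₂ (E.stack k₀) = x.map (E.symbol k₀) := by
    rw [src₂, src₁, aux₁']
    simp [List.filterMap_map, List.filterMap_eq_map']
  have stack₂ : ∀ k, S₂ (E.stack k) =
      ((Function.update (fun _ => []) k₀ x : ∀ k, List (Γ k)) k).map (E.symbol k) := by
    intro k
    rcases eq_or_ne k k₀ with rfl | hk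
    · simpa using src₂'
    · have h1 := E.stack_injective.ne hk
      rw [other₂ _ (nea k) h1 (disjoint k j₀), other₁ _ h1 (nea k) (disjoint k j₀)]
      simp [hk, h1]
  have stackD₂ : ∀ j, j ≠ j₀ → S₂ (D.stack j) = [] := by
    intro j hj
    have h1 := D.stack_injective.ne hj
    have h2 := (disjoint k₀ j).symm
    rw [other₂ _ (neda j) h2 h1, other₁ _ h2 (neda j) h1, Function.update_of_ne h2]
  -- With `i` steps to go, `n - i` blanks lie on top of the copy. The conjunct `i ≤ n` keeps the
  -- subtraction from truncating.
  obtain ⟨⟨l₃, v₃, S₃⟩, run₃, ⟨h1, h2, h3⟩, aux₃, D₃, stackD₃⟩ := E.runsTo (m' := m')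
    (fun i S' => S' aux = [] ∧
      S' (D.stack j₀) = ((List.replicate (n - i) none ++ (x.map some).reverse).map ψ).map
        (D.symbol j₀) ∧
      i ≤ n ∧ ∀ j, j ≠ j₀ → S' (D.stack j) = [])
    (by
      rintro i l v S v' S' hv hS ⟨ha, hD, hi, hj⟩
      obtain ⟨h1, h2⟩ := E.stepAux_translate (m l) v S v'
        (Function.update S' (D.stack j₀) (D.symbol j₀ (ψ none) :: S' (D.stack j₀))) hv
        (fun k => by rw [Function.update_of_ne (disjoint k j₀), hS])
      rw [label, TM2.stepAux]
      refine ⟨h1, ?_, ?_, by omega, ?_⟩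
      · rw [h2 _ hauxE, Function.update_of_ne (neda j₀).symm, ha]
      · rw [h2 _ (by rintro ⟨k, hk⟩; exact disjoint k j₀ hk), Function.update_self, hD,
          show n - i = n - (i + 1) + 1 by omega, List.replicate_succ]
        rfl
      · intro j hjj
        rw [h2 _ (by rintro ⟨k, hk⟩; exact disjoint k j hk),
          Function.update_of_ne (D.stack_injective.ne hjj), hj j hjj])
    (i := 0) hrun (c' := ⟨some (E.label main), w₀, S₂⟩) ⟨rfl, get, stack₂⟩
    ⟨aux₂, by simpa using D₂', by omega, stackD₂⟩
  obtain rfl : l₃ = some E.exit := h1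
  replace aux₃ : S₃ aux = [] := aux₃
  replace D₃ : S₃ (D.stack j₀) =
    ((List.replicate n none ++ (x.map some).reverse).map ψ).map (D.symbol j₀) := D₃
  replace stackD₃ : ∀ j, j ≠ j₀ → S₃ (D.stack j) = [] := stackD₃.2
  replace h3 : ∀ k, S₃ (E.stack k) =
    ((Function.update (fun _ => []) k₁ r : ∀ k, List (Γ k)) k).map (E.symbol k) := h3
  -- The output of the first machine is erased: only its number of steps matters.
  obtain ⟨v₄, S₄, run₄, src₄, aux₄, D₄, other₄⟩ := runsTo_moveLoop exit (nea k₁).symm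
    (disjoint k₁ j₀).symm (neda j₀) hp₃ (fun _ => none) (fun _ x => by cases x <;> rfl)
    (fun _ => none) (fun _ x => by cases x <;> rfl) (r.map (E.symbol k₁)) v₃ S₃
    (by rw [h3]; simp)
  simp only [TM2.stepAux] at run₄
  obtain ⟨⟨l₅, v₅, S₅⟩, run₅, ⟨g1, g2, g3⟩, g4⟩ := D.runsTo (m' := m')
    (fun _ S' => ∀ j ∉ Set.range D.stack, S' j = [])
    (by
      intro i l v S v' S' hv hS hP
      obtain ⟨h1, h2⟩ := D.stepAux_translate (mD l) v S v' S' hv hS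
      rw [labelD]
      exact ⟨h1, fun j hj => (h2 j hj).trans (hP j hj)⟩)
    (i := 0) hrunD (c' := ⟨some (D.label mainD), w₀, S₄⟩)
    ⟨rfl, getD, by
      intro j
      rcases eq_or_ne j j₀ with rfl | hj
      · simpa using D₄.trans (by simpa using D₃)
      · simp [hj, other₄ _ (disjoint k₁ j).symm (neda j) (D.stack_injective.ne hj),
          stackD₃ j hj]⟩
    (by
      intro j hj
      simp only
      rcases cover j with ⟨k, rfl⟩ | hj' | rfl
      · rcases eq_or_ne k k₁ with rfl | hk
        · exact src₄
        · rw [other₄ _ (E.stack_injective.ne hk) (nea k) (disjoint k j₀), h3]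
          simp [hk]
      · exact absurd hj' hj
      · simpa [aux₃] using aux₄)
  obtain rfl : l₅ = some D.exit := g1
  have run₆ : RunsTo (TM2.step m') 1 ⟨some D.exit, v₅, S₅⟩
      ⟨none, w₀, Function.update (fun _ => []) (D.stack j₁) (y.map (D.symbol j₁))⟩ := by
    refine RunsTo.single ?_
    rw [TM2.step, exitD, TM2.stepAux, TM2.stepAux]
    congr 2
    funext j
    by_cases hj : j ∈ Set.range D.stack
    · obtain ⟨j, rfl⟩ := hj
      rw [map_update_nil]
      exact g3 j
    · rw [Function.update_of_ne (fun h => hj ⟨j₁, h.symm⟩)]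
      exact g4 j hj
  have l₁ := run₁.trans (run₂.trans (run₃.trans (run₄.trans (run₅.trans run₆))))
  simpa [aux₁'] using l₁

end Programs

/-! ### Closure properties of time-bounded computation -/

theorem computesInTime_iff {Γ₀ Γ₁ : Type} {F : List Γ₀ → List Γ₁} {t : List Γ₀ → ℕ} :
    ComputesInTime F t ↔ ∃ M : TM2ComputableAux Γ₀ Γ₁, ∀ x, ∃ n ≤ t x,
      Outputs M.tm n (x.map M.inputAlphabet.symm) ((F x).map M.outputAlphabet.symm) :=
  exists_congr fun _ => forall_congr' fun _ => nonempty_outputsInTime_iff _ _ _ _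

/-- The output of a machine is no longer than its input and its running time permit. -/
theorem exists_length_output_le {Γ₀ Γ₁ : Type} (M : TM2ComputableAux Γ₀ Γ₁) :
    ∃ d : ℕ, ∀ n (x : List Γ₀) (y : List Γ₁), Outputs M.tm n (x.map M.inputAlphabet.symm) (y.map M.outputAlphabet.symm) →
      y.length ≤ x.length + d * n := by
  have := M.tm.ΛFin
  obtain ⟨d, hd⟩ := exists_stack_growth M.tm.m
  refine ⟨d, fun n x y h => ?_⟩
  have := hd _ _ _ h M.tm.k₁
  simp only [Function.update_self, List.length_map] at this
  refine this.trans (Nat.add_le_add_right ?_ _)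
  -- The output stack may be the input stack, and then it already holds `x`.
  rcases eq_or_ne M.tm.k₁ M.tm.k₀ with hk | hk
  · rw [hk]; simp
  · simp [hk]

/-- A decider can be turned into a machine that writes a symbol depending on the decision. -/
theorem ComputesInTime.rewriteOutput {Γ₀ Γ₂ : Type} {F : List Γ₀ → Bool} {t : List Γ₀ → ℕ}
    (h : ComputesInTime (fun x => [F x]) t) (g : Bool → Option Γ₂) :
    ComputesInTime (fun x => (g (F x)).toList) fun x => t x + 1 := by
  rw [computesInTime_iff] at h ⊢
  obtain ⟨⟨M, inA, outA⟩, hM⟩ := h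
  let := M.kFin
  let := M.ΛFin
  let := M.σFin
  let := M.Γk₀Fin
  let Γ' : M.K ⊕ Unit → Type := Sum.elim M.Γ fun _ => Γ₂
  let E : Subroutine M.Γ M.Λ M.σ Γ' (Option M.Λ) (M.σ × Bool) :=
    { stack := Sum.inl
      stack_injective := Sum.inl_injective
      symbol := fun k => Equiv.refl (M.Γ k)
      label := some
      exit := none
      get := Prod.fst
      set := fun s s' => (s, s'.2)
      get_set := fun _ _ => rfl }
  let f : M.σ × Bool → Option (Γ' (Sum.inl M.k₁)) → M.σ × Bool :=
    fun s a => (s.1, a.elim false outA)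
  let N : FinTM2 :=
    { K := M.K ⊕ Unit
      k₀ := Sum.inl M.k₀
      k₁ := Sum.inr ()
      Γ := Γ'
      Λ := Option M.Λ
      main := some M.main
      σ := M.σ × Bool
      initialState := (M.initialState, false)
      Γk₀Fin := M.Γk₀Fin
      m := fun l => l.elim
        (.pop (Sum.inl M.k₁) f (pushOption (Sum.inr ()) (fun s => g s.2)
          (.load (fun _ => (M.initialState, false)) .halt)))
        fun l => E.translate (M.m l) }
  refine ⟨⟨N, inA, Equiv.refl Γ₂⟩, fun x => ?_⟩
  obtain ⟨n, hn, h⟩ := hM x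
  refine ⟨n + 1, Nat.add_le_add_right hn 1, ?_⟩
  have := runsTo_rewriteOutput E (m := M.m) (m' := N.m) (f := f) (g := fun s => g s.2)
    (out := Sum.inr ()) (w₀ := (M.initialState, false)) (o := g (F x)) (r := outA.symm (F x))
    (fun _ => rfl) rfl (by rintro (k | k); exacts [Or.inl ⟨k, rfl⟩, Or.inr rfl])
    (by rintro ⟨k, hk⟩; cases hk) rfl
    (fun _ => congrArg g (outA.apply_symm_apply (F x))) h
  have e : ∀ l : List (M.Γ M.k₀), l.map (E.symbol M.k₀) = l := fun l => List.map_id l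
  have e' : ∀ l : List Γ₂, l.map (Equiv.refl Γ₂).symm = l := fun l => List.map_id l
  rw [e] at this
  exact (congrArg (fun l : List Γ₂ => Outputs N (n + 1) (x.map inA.symm) l)
    (e' (g (F x)).toList)).mpr this

/-- A constant function whose value is a single symbol is computed in linear time. -/
theorem computesInTime_singleton {Γ₀ Γ₁ : Type} [Finite Γ₀] (c : Γ₁) :
    ComputesInTime (fun _ : List Γ₀ => [c]) fun x => x.length + 1 := by
  rw [computesInTime_iff]
  let := Fintype.ofFinite Γ₀
  -- The stack `some false` is a dummy, the second target that `moveLoop` asks for.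
  let Γ' : Option Bool → Type := fun k => k.elim Γ₀ fun _ => Γ₁
  let f : Bool → Option (Γ' none) → Bool := fun _ a => a.isSome
  let N : FinTM2 :=
    { K := Option Bool
      k₀ := none
      k₁ := some true
      Γ := Γ'
      Λ := Unit
      main := ()
      σ := Bool
      initialState := false
      Γk₀Fin := (inferInstance : Fintype Γ₀)
      m := fun _ => moveLoop () none f id (some true) (fun _ => none) (some false) (fun _ => none)
        (.push (some true) (fun _ => c) (.load (fun _ => false) .halt)) }
  refine ⟨⟨N, Equiv.refl Γ₀, Equiv.refl Γ₁⟩, fun x => ⟨x.length + 1, le_rfl, ?_⟩⟩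
  have run := runsTo_singleton (m' := N.m) (L := ()) (src := none) (out := some true)
    (aux := some false) (w₀ := false) (f := f) (p := id) (c := c) rfl (fun _ _ => rfl) (by rintro ⟨⟩)
    (by rintro ⟨⟩) (by rintro ⟨⟩) (by rintro (_ | _ | _) <;> simp) x
  have e : ∀ l : List Γ₀, l.map (Equiv.refl Γ₀).symm = l := fun l => List.map_id l
  exact (congrArg (fun l : List Γ₀ => Outputs N (x.length + 1) l [c]) (e x)).mpr run

theorem unpad_map {α β : Type} (f : α → β) (l : List (Option α)) :
    unpad (l.map (Option.map f)) = (unpad l).map f := by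
  rw [unpad, List.reduceOption_map, unpad, List.map_reverse]

theorem padding_map {α β : Type} (f : α → β) (l : List (Option α)) :
    padding (l.map (Option.map f)) = padding l := by
  rw [padding, List.countP_map, padding]
  congr 1
  funext a
  cases a <;> rfl

/-- The word `x`, written backwards, with padding of length `n`. -/
def pad {α : Type} (n : ℕ) (x : List α) : List (Option α) :=
  List.replicate n none ++ (x.map some).reverse

theorem unpad_pad {α : Type} (n : ℕ) (x : List α) : unpad (pad n x) = x := by
  rw [unpad, pad, List.reduceOption_append, List.reduceOption_replicate_none, ← List.map_reverse]
  simp [List.reduceOption]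

theorem padding_pad {α : Type} (n : ℕ) (x : List α) : padding (pad n x) = n := by
  rw [padding, pad, List.countP_append, List.countP_reverse, List.countP_map]
  simp [List.countP_replicate, Function.comp_def]

theorem length_pad {α : Type} (n : ℕ) (x : List α) : (pad n x).length = n + x.length := by
  simp [pad]

open Classical in
/-- A machine can be run on a padded input for as many steps as there is padding. -/
theorem exists_computesInTime_clocked {Γ₀ Γ₁ : Type} {F : List Γ₀ → List Γ₁}
    (M : TM2ComputableAux Γ₀ Γ₁) (T : List Γ₀ → ℕ)
    (hM : ∀ x, Outputs M.tm (T x) (x.map M.inputAlphabet.symm)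
      ((F x).map M.outputAlphabet.symm)) :
    ∃ d : ℕ, ComputesInTime (fun w : List (Option Γ₀) =>
      if T (unpad w) ≤ padding w then F (unpad w) else []) fun w => d * w.length + 3 := by
  obtain ⟨M, inA, outA⟩ := M
  let := M.kFin
  let := M.ΛFin
  let := M.σFin
  let := M.Γk₀Fin
  obtain ⟨d, hd⟩ := exists_stack_growth M.m
  refine ⟨d + 3, computesInTime_iff.2 ?_⟩
  let Γ' : M.K ⊕ Bool → Type := Sum.elim M.Γ fun b => Bool.rec (Option (M.Γ M.k₀)) Unit b
  let σ' : Type := M.σ × Option (Option (M.Γ M.k₀)) × Bool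
  let E : Subroutine M.Γ M.Λ M.σ Γ' (M.Λ ⊕ Option Bool) σ' :=
    { stack := Sum.inl
      stack_injective := Sum.inl_injective
      symbol := fun k => Equiv.refl (M.Γ k)
      label := Sum.inl
      exit := Sum.inr none
      get := Prod.fst
      set := fun s s' => (s, s'.2)
      get_set := fun _ _ => rfl }
  let w₀ : σ' := (M.initialState, none, false)
  let f : σ' → Option (Γ' (Sum.inr false)) → σ' := fun s a => (s.1, a, s.2.2)
  let g : σ' → Option (Γ' (Sum.inr true)) := fun s =>
    s.2.1.bind fun y => y.elim (some ()) fun _ => none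
  let h : σ' → Option (Γ' (Sum.inl M.k₀)) := fun s => s.2.1.bind id
  let flag : σ' → Option (Γ' (Sum.inr true)) → σ' := fun s a => (s.1, s.2.1, a.isSome)
  let isSet : σ' → Bool := fun s => s.2.2
  let clear : σ' → σ' := fun s => (s.1, s.2.1, false)
  let raise : σ' → σ' := fun s => (s.1, s.2.1, true)
  let ks : List (M.K ⊕ Bool) := Finset.univ.toList
  let N : FinTM2 :=
    { K := M.K ⊕ Bool
      k₀ := Sum.inr false
      k₁ := Sum.inl M.k₁
      Γ := Γ'
      Λ := M.Λ ⊕ Option Bool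
      main := Sum.inr (some false)
      σ := M.σ × Option (Option (M.Γ M.k₀)) × Bool
      initialState := w₀
      Γk₀Fin := (inferInstance : Fintype (Option (M.Γ M.k₀)))
      m := Sum.elim
        (fun l => .pop (Sum.inr true) flag (.branch isSet (E.translate (M.m l))
          (.goto fun _ => Sum.inr (some true))))
        fun i => i.elim
          (moveLoop E.exit (Sum.inr true) flag isSet (Sum.inr false) (fun _ => none)
            (Sum.inl M.k₀) (fun _ => none) (.load (fun _ => w₀) .halt))
          fun b => Bool.rec
            (moveLoop (Sum.inr (some false)) (Sum.inr false) f (fun s => s.2.1.isSome)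
              (Sum.inr true) g (Sum.inl M.k₀) h
              (.load (fun _ => w₀) (.goto fun _ => Sum.inl M.main)))
            (.load clear (popAll raise (.branch isSet (.goto fun _ => Sum.inr (some true))
              (.load (fun _ => w₀) .halt)) ks)) b }
  refine ⟨⟨N, Equiv.optionCongr inA, outA⟩, fun w => ?_⟩
  have e : ((w.map (Equiv.optionCongr inA).symm).map id) = w.map (Option.map inA.symm) := by
    rw [List.map_id]; rfl
  have hrun := hM (unpad w)
  simp only at hrun
  rw [← unpad_map, ← e] at hrun
  obtain ⟨n, hn, run, run'⟩ := exists_runsTo_clocked E (m := M.m) (m' := N.m) (inp := Sum.inr false)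
    (cnt := Sum.inr true) (w₀ := w₀) (ι := id) (tick := ()) (f := f) (g := g) (h := h)
    (p := fun s => s.2.1.isSome) (flag := flag) (isSet := isSet) (clear := clear)
    (raise := raise) (ks := ks) (readLabel := Sum.inr (some false))
    (abortLabel := Sum.inr (some true)) rfl (fun _ => rfl) rfl rfl (fun _ _ => rfl)
    (fun _ _ => rfl) (fun _ x => by rcases x with _ | _ | _ <;> rfl) (fun _ _ => rfl)
    (fun _ _ => rfl) (fun _ => rfl) (fun _ => rfl) (fun _ => rfl)
    (by
      rintro (k | _ | _)
      exacts [Or.inl ⟨k, rfl⟩, Or.inr (Or.inl rfl), Or.inr (Or.inr rfl)])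
    (by rintro ⟨k, hk⟩; cases hk) (by rintro ⟨k, hk⟩; cases hk) (by rintro ⟨⟩)
    (Finset.nodup_toList _) (fun k => Finset.mem_toList.2 (Finset.mem_univ _)) rfl
    (w := w.map (Equiv.optionCongr inA).symm) hd hrun
  have hpad : padding ((w.map (Equiv.optionCongr inA).symm).map id) = padding w := by
    rw [e, padding_map]
  have e' : ∀ l : List (M.Γ M.k₁), l.map (E.symbol M.k₁) = l := fun l => List.map_id l
  rw [e'] at run
  refine ⟨n, hn.trans_eq (congrArg (fun k => (d + 3) * k + 3) (List.length_map _)), ?_⟩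
  by_cases hT : T (unpad w) ≤ padding w
  · rw [if_pos hT]
    exact run (hT.trans hpad.ge)
  · rw [if_neg hT]
    have nil : Function.update (fun _ => []) (Sum.inl M.k₁) [] = fun k => ([] : List (Γ' k)) :=
      Function.update_eq_self (Sum.inl M.k₁) (fun _ => [])
    exact (congrArg (fun S : ∀ k, List (Γ' k) => RunsTo (TM2.step N.m) n
      ⟨some (Sum.inr (some false)), w₀, Function.update (fun _ => []) (Sum.inr false)
        (w.map (Equiv.optionCongr inA).symm)⟩ ⟨none, w₀, S⟩) nil).mpr
      (run' (hpad.trans_lt (not_le.1 hT)))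

/-- A machine can be run on an input padded by the number of steps that another machine takes. -/
theorem ComputesInTime.pad {Γ₀ Γ₁ Γ₂ : Type} {F : List Γ₀ → List Γ₁}
    (M : TM2ComputableAux Γ₀ Γ₁) (T : List Γ₀ → ℕ)
    (hM : ∀ x, Outputs M.tm (T x) (x.map M.inputAlphabet.symm)
      ((F x).map M.outputAlphabet.symm))
    {G : List (Option Γ₀) → List Γ₂} {t : List (Option Γ₀) → ℕ} (hG : ComputesInTime G t) :
    ComputesInTime (fun x => G (pad (T x) x))
      fun x => 2 * x.length + T x + (F x).length + t (pad (T x) x) + 4 := by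
  obtain ⟨M, inA, outA⟩ := M
  rw [computesInTime_iff] at hG ⊢
  obtain ⟨⟨D, inD, outD⟩, hD⟩ := hG
  let := M.kFin
  let := M.ΛFin
  let := M.σFin
  let := M.Γk₀Fin
  let := D.kFin
  let := D.ΛFin
  let := D.σFin
  let Γ' : M.K ⊕ D.K ⊕ Unit → Type := Sum.elim M.Γ (Sum.elim D.Γ fun _ => M.Γ M.k₀)
  let Λ' : Type := M.Λ ⊕ D.Λ ⊕ Bool × Bool
  let σ' : Type := M.σ × D.σ × Option (M.Γ M.k₀) × Bool
  let E : Subroutine M.Γ M.Λ M.σ Γ' Λ' σ' :=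
    { stack := Sum.inl
      stack_injective := Sum.inl_injective
      symbol := fun k => Equiv.refl (M.Γ k)
      label := Sum.inl
      exit := Sum.inr (Sum.inr (true, false))
      get := Prod.fst
      set := fun s s' => (s, s'.2)
      get_set := fun _ _ => rfl }
  let E' : Subroutine D.Γ D.Λ D.σ Γ' Λ' σ' :=
    { stack := fun k => Sum.inr (Sum.inl k)
      stack_injective := Sum.inr_injective.comp Sum.inl_injective
      symbol := fun k => Equiv.refl (D.Γ k)
      label := fun l => Sum.inr (Sum.inl l)
      exit := Sum.inr (Sum.inr (true, true))
      get := fun s => s.2.1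
      set := fun s s' => (s'.1, s, s'.2.2)
      get_set := fun _ _ => rfl }
  let w₀ : σ' := (M.initialState, D.initialState, none, false)
  let ψ : Option (M.Γ M.k₀) → D.Γ D.k₀ := fun a => inD.symm (a.map inA)
  let p : σ' → Bool := fun s => s.2.2.2
  let f₁ : σ' → Option (Γ' (Sum.inl M.k₀)) → σ' := fun s a => (s.1, s.2.1, a, a.isSome)
  let g₁ : σ' → Option (Γ' (Sum.inr (Sum.inr ()))) := fun s => s.2.2.1
  let h₁ : σ' → Option (Γ' (Sum.inr (Sum.inl D.k₀))) := fun s => s.2.2.1.map fun y => ψ (some y)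
  let f₂ : σ' → Option (Γ' (Sum.inr (Sum.inr ()))) → σ' := fun s a => (s.1, s.2.1, a, a.isSome)
  let g₂ : σ' → Option (Γ' (Sum.inl M.k₀)) := fun s => s.2.2.1
  let f₃ : σ' → Option (Γ' (Sum.inl M.k₁)) → σ' := fun s a => (s.1, s.2.1, none, a.isSome)
  let copyLabel : Λ' := Sum.inr (Sum.inr (false, false))
  let restoreLabel : Λ' := Sum.inr (Sum.inr (false, true))
  let N : FinTM2 :=
    { K := M.K ⊕ D.K ⊕ Unit
      k₀ := Sum.inl M.k₀
      k₁ := Sum.inr (Sum.inl D.k₁)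
      Γ := Γ'
      Λ := M.Λ ⊕ D.Λ ⊕ Bool × Bool
      main := copyLabel
      σ := M.σ × D.σ × Option (M.Γ M.k₀) × Bool
      initialState := w₀
      Γk₀Fin := M.Γk₀Fin
      m := Sum.elim
        (fun l => .push (Sum.inr (Sum.inl D.k₀)) (fun _ => ψ none) (E.translate (M.m l)))
        (Sum.elim (fun l => E'.translate (D.m l)) fun i => Bool.rec
          (Bool.rec
            (moveLoop copyLabel (Sum.inl M.k₀) f₁ p (Sum.inr (Sum.inr ())) g₁
              (Sum.inr (Sum.inl D.k₀)) h₁ (.load (fun _ => w₀) (.goto fun _ => restoreLabel)))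
            (moveLoop restoreLabel (Sum.inr (Sum.inr ())) f₂ p (Sum.inl M.k₀) g₂
              (Sum.inr (Sum.inl D.k₀)) (fun _ => none)
              (.load (fun _ => w₀) (.goto fun _ => E.label M.main))) i.2)
          (Bool.rec
            (moveLoop E.exit (Sum.inl M.k₁) f₃ p (Sum.inr (Sum.inr ())) (fun _ => none)
              (Sum.inr (Sum.inl D.k₀)) (fun _ => none)
              (.load (fun _ => w₀) (.goto fun _ => E'.label D.main)))
            (.load (fun _ => w₀) .halt) i.2) i.1) }
  refine ⟨⟨N, inA, outD⟩, fun x => ?_⟩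
  obtain ⟨n, hn, hrunD⟩ := hD (QParam.pad (T x) x)
  have e : (QParam.pad (T x) x).map inD.symm =
      (List.replicate (T x) none ++ ((x.map inA.symm).map some).reverse).map ψ := by
    simp [QParam.pad, ψ, Function.comp_def]
  simp only at hrunD
  rw [e] at hrunD
  have run := runsTo_padded E E' (m := M.m) (mD := D.m) (m' := N.m) (aux := Sum.inr (Sum.inr ()))
    (w₀ := w₀) (copyLabel := copyLabel) (restoreLabel := restoreLabel) (ψ := ψ)
    (α := Equiv.refl (M.Γ M.k₀)) (p := p) (f₁ := f₁) (g₁ := g₁) (h₁ := h₁) (f₂ := f₂) (g₂ := g₂)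
    (f₃ := f₃) rfl rfl (fun _ => rfl) rfl (fun _ => rfl) rfl (fun _ _ => rfl) (fun _ _ => rfl)
    (fun _ _ => rfl) (fun _ x => by cases x <;> rfl) (fun _ x => by cases x <;> rfl)
    (fun _ x => by cases x <;> rfl)
    (by
      rintro (k | k | _)
      exacts [Or.inl ⟨k, rfl⟩, Or.inr (Or.inl ⟨k, rfl⟩), Or.inr (Or.inr rfl)])
    (fun k j hk => by cases hk) (by rintro ⟨k, hk⟩; cases hk) (by rintro ⟨k, hk⟩; cases hk) rfl rfl
    (hM x) hrunD
  -- Copying, restoring, the first run, erasing its output, the second run, and a final step that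
  -- resets the state.
  refine ⟨(x.length + 1) + ((x.length + 1) + (T x + (((F x).length + 1) + (n + 1)))), by omega, ?_⟩
  simp only [List.length_map] at run
  have e : ∀ l : List (M.Γ M.k₀), l.map (E.symbol M.k₀) = l := fun l => List.map_id l
  have e' : ∀ l : List (D.Γ D.k₁), l.map (E'.symbol D.k₁) = l := fun l => List.map_id l
  rw [e, e'] at run
  exact run

/-! ### Polynomial bounds -/

theorem eval_mono (p : Polynomial ℕ) {m n : ℕ} (h : m ≤ n) : p.eval m ≤ p.eval n := by
  rw [Polynomial.eval_eq_sum, Polynomial.eval_eq_sum]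
  exact Finset.sum_le_sum fun i _ => Nat.mul_le_mul_left _ (Nat.pow_le_pow_left h i)

/-- A single power, unlike a general polynomial, splits over a product; this separates the parameter
from the length in `FPTBounded.eval`. -/
theorem exists_eval_le (p : Polynomial ℕ) : ∃ c d : ℕ, ∀ n, p.eval n ≤ c * (n + 1) ^ d := by
  induction p using Polynomial.induction_on' with
  | add p q hp hq =>
    obtain ⟨c₁, d₁, h₁⟩ := hp
    obtain ⟨c₂, d₂, h₂⟩ := hq
    refine ⟨c₁ + c₂, d₁ + d₂, fun n => ?_⟩
    rw [Polynomial.eval_add, Nat.add_mul]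
    exact Nat.add_le_add
      ((h₁ n).trans (Nat.mul_le_mul_left _ (Nat.pow_le_pow_right n.succ_pos (by omega))))
      ((h₂ n).trans (Nat.mul_le_mul_left _ (Nat.pow_le_pow_right n.succ_pos (by omega))))
  | monomial d a =>
    refine ⟨a, d, fun n => ?_⟩
    rw [Polynomial.eval_monomial]
    exact Nat.mul_le_mul_left _ (Nat.pow_le_pow_left n.le_succ d)

/-- Bounds of the form `f (κ x) * p |x|` are preserved by polynomials. -/
theorem FPTBounded.eval {Γ : Type} {κ : List Γ → ℕ+} {t : List Γ → ℕ} (h : FPTBounded κ t)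
    (q : Polynomial ℕ) {s : List Γ → ℕ} (hs : ∀ x, s x ≤ q.eval (t x + x.length)) :
    FPTBounded κ s := by
  obtain ⟨f, hf, p, hp⟩ := h
  obtain ⟨c, d, hq⟩ := exists_eval_le q
  -- With `n = |x|`, this rests on `f * p + n + 1 ≤ (f + 1) * (p + n + 1)`.
  refine ⟨fun k => c * (f k + 1) ^ d, ?_, (p + Polynomial.X + 1) ^ d, fun x => ?_⟩
  · exact Primrec.nat_mul.to_comp.comp (Computable.const c)
      ((Primrec₂.unpaired'.1 Nat.Primrec.pow).to_comp.comp
        (Computable.succ.comp hf) (Computable.const d))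
  · refine (hs x).trans ((hq _).trans ?_)
    rw [Polynomial.eval_pow, mul_assoc, ← mul_pow]
    refine Nat.mul_le_mul_left _ (Nat.pow_le_pow_left ?_ d)
    simp only [Polynomial.eval_add, Polynomial.eval_X, Polynomial.eval_one]
    have := hp x
    nlinarith [Nat.zero_le (f (κ x) * x.length), Nat.zero_le (f (κ x)),
      Nat.zero_le (p.eval x.length)]

/-! ### Circuits -/

/-- The circuit that accepts with certainty if `b` is true, and rejects with certainty if not. -/
def QCircuit.ofBool (b : Bool) : QCircuit := ⟨0, if b then [Gate.X 0] else []⟩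

/-- Without ancillas the description has at most one symbol, so a verdict can be rewritten into it;
the empty word describes the rejecting circuit. -/
theorem QCircuit.encode_ofBool (b : Bool) :
    (QCircuit.ofBool b).encode = (if b then some CSymbol.x else none).toList := by
  cases b <;> rfl

theorem QCircuit.size_ofBool_le (b : Bool) : (QCircuit.ofBool b).size ≤ 2 := by
  cases b <;> simp [ofBool, size]

theorem QCircuit.acceptProb_ofBool (b : Bool) :
    (QCircuit.ofBool b).acceptProb = if b then 1 else 0 := by
  have key : ∀ φ : (Fin 1 → Bool) → ℝ, ∑ x, φ x = φ (fun _ => true) + φ fun _ => false := by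
    intro φ
    rw [← (Equiv.funUnique (Fin 1) Bool).symm.sum_comp φ, Fintype.sum_bool]
    rfl
  have single : zeroState 1 (fun _ => true) = 0 :=
    Pi.single_eq_of_ne (fun h => Bool.noConfusion (congrFun h 0)) _
  have single' : zeroState 1 (fun _ => false) = 1 := Pi.single_eq_same _ _
  have flip : Function.update (fun _ : Fin 1 => true) 0 (!true) = fun _ => false := by
    funext i
    simp [Subsingleton.elim i 0]
  have final : (QCircuit.ofBool b).finalState (fun _ => true) = if b then 1 else 0 := by
    cases b
    · exact single
    · exact (congrArg (zeroState 1) flip).trans single'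
  unfold acceptProb
  refine (key _).trans ?_
  rw [if_pos rfl, if_neg Bool.false_ne_true]
  refine (congrArg (fun z : ℂ => ‖z‖ ^ 2 + 0) final).trans ?_
  cases b <;> simp

/-- Every gate contributes at least its name to the description, and the `1` is the output qubit.
Circuit size is thus controlled by the length of the machine's output. -/
theorem QCircuit.size_le (C : QCircuit) : C.size ≤ C.encode.length + 1 := by
  have : C.gates.length ≤ (C.gates.flatMap Gate.encode).length := by
    induction C.gates with
    | nil => simp
    | cons g l ih =>
      have : 1 ≤ g.encode.length := by cases g <;> simp [Gate.encode]
      rw [List.flatMap_cons, List.length_append, List.length_cons]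
      omega
  rw [size, encode, List.length_append, List.length_replicate]
  omega

open Classical in
theorem boundedErrorDecides_ofBool {Γ : Type} (L : Language Γ) :
    BoundedErrorDecides (fun x => QCircuit.ofBool (decide (x ∈ L))) L := by
  intro x
  rw [QCircuit.acceptProb_ofBool]
  constructor
  · intro h
    simp only [h, decide_true, if_true]
    norm_num
  · intro h
    simp only [h, decide_false]
    norm_num

/-! ### The inclusions between the classes -/

theorem classP_subset_classBQP : ClassP ⊆ ClassBQP := by
  rintro A ⟨t, ⟨p, hp⟩, h⟩
  have h' := ComputesInTime.rewriteOutput h fun b => if b then some CSymbol.x else none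
  simp only [← QCircuit.encode_ofBool] at h'
  refine ⟨_, ⟨_, ⟨p + 1, fun x => ?_⟩, h'⟩, ⟨2, fun x => ?_⟩, boundedErrorDecides_ofBool _⟩
  · simpa using hp x
  · simpa using QCircuit.size_ofBool_le _

theorem classFPT_subset_classFPQT : ClassFPT ⊆ ClassFPQT := by
  rintro A ⟨t, ht, h⟩
  have h' := ComputesInTime.rewriteOutput h fun b => if b then some CSymbol.x else none
  simp only [← QCircuit.encode_ofBool] at h'
  refine ⟨_, ⟨_, ht.eval (Polynomial.X + 1) fun x => ?_, h'⟩, ht.eval 2 fun x => ?_,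
    boundedErrorDecides_ofBool _⟩
  · simp
  · simpa using QCircuit.size_ofBool_le _

/-- A problem with the constant parameterization. -/
def Problem.withConstParam (A : Problem) : ParamProblem where
  toProblem := A
  κ := fun _ => 1
  κ_polyTime :=
    have := A.finite
    -- The binary notation of `1` is the single digit `true`.
    ⟨_, ⟨Polynomial.X + 1, fun x => by simp⟩, computesInTime_singleton true⟩

theorem classBQP_subset_classP (h : ClassFPQT ⊆ ClassFPT) : ClassBQP ⊆ ClassP := by
  rintro A ⟨C, ⟨t, ⟨p, hp⟩, hC⟩, ⟨q, hq⟩, hA⟩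
  have : A.withConstParam ∈ ClassFPQT :=
    ⟨C, ⟨t, ⟨fun _ => 1, Computable.const 1, p, fun x =>
      (hp x).trans_eq (one_mul _).symm⟩, hC⟩,
      ⟨fun _ => 1, Computable.const 1, q, fun x => (hq x).trans_eq (one_mul _).symm⟩, hA⟩
  obtain ⟨s, ⟨f, -, r, hr⟩, hs⟩ := h this
  refine ⟨s, ⟨Polynomial.C (f 1) * r, fun x => ?_⟩, hs⟩
  rw [Polynomial.eval_mul, Polynomial.eval_C]
  exact hr x

/-- The padding argument: enough blanks make the FPT-time construction of the circuit linear in the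
padded length. -/
theorem classFPQT_subset_classFPT (h : ClassBQP ⊆ ClassP) : ClassFPQT ⊆ ClassFPT := by
  classical
  rintro A ⟨C, ⟨t, ht, hC⟩, -, hA⟩
  obtain ⟨M, hM⟩ := computesInTime_iff.1 hC
  choose T hTt hT using hM
  obtain ⟨d, hd⟩ := exists_computesInTime_clocked M T hT
  obtain ⟨e, he⟩ := exists_length_output_le M
  have := A.finite
  let L : Language (Option A.alphabet) := {w | T (unpad w) ≤ padding w ∧ unpad w ∈ A.lang}
  let C' : List (Option A.alphabet) → QCircuit := fun w =>
    if T (unpad w) ≤ padding w then C (unpad w) else QCircuit.ofBool false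
  have hL : (⟨Option A.alphabet, L⟩ : Problem) ∈ ClassBQP := by
    refine ⟨C', ⟨fun w => d * w.length + 3, ⟨Polynomial.C d * Polynomial.X + 3, fun w => ?_⟩, ?_⟩,
      ⟨Polynomial.C (e + 1) * Polynomial.X + 1, fun w => ?_⟩, fun w => ?_⟩
    · simp
    -- When the clock expires, the empty output is the description of `QCircuit.ofBool false`.
    · convert hd using 2 with w
      exact apply_ite QCircuit.encode _ _ _
    · refine (QCircuit.size_le _).trans ?_
      simp only [Polynomial.eval_add, Polynomial.eval_mul, Polynomial.eval_C, Polynomial.eval_X,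
        Polynomial.eval_one]
      refine Nat.add_le_add_right ?_ 1
      by_cases hw : T (unpad w) ≤ padding w
      · simp only [C', if_pos hw]
        -- The description has length at most `|unpad w| + e * T`, and both `|unpad w|` and `T` are
        -- at most `|w|`; hence the factor `e + 1`.
        have h1 := he _ _ _ (hT (unpad w))
        have h2 := Nat.mul_le_mul_left e (hw.trans (padding_le w))
        have h3 := length_unpad_le w
        linarith
      · simp only [C', if_neg hw]
        exact Nat.zero_le _
    · by_cases hw : T (unpad w) ≤ padding w
      · simp only [C', if_pos hw]
        exact ⟨fun h => (hA _).1 h.2, fun h => (hA _).2 fun h' => h ⟨hw, h'⟩⟩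
      · simp only [C', if_neg hw, QCircuit.acceptProb_ofBool]
        exact ⟨fun h => absurd h.1 hw, fun _ => by norm_num⟩
  obtain ⟨s, ⟨p, hp⟩, hs⟩ := h hL
  have hpad := ComputesInTime.pad M T hT hs
  refine ⟨fun x => 2 * x.length + T x + (C x).encode.length + s (pad (T x) x) + 4,
    -- The description of `C x` has length at most `|x| + e * T x`, so the linear terms add up to `3
    -- * |x| + (e + 1) * T x`; `p` bounds the decider on a word of length `T x + |x|`.
    ht.eval (Polynomial.C (e + 3) * Polynomial.X + p + 4) fun x => ?_, ?_⟩
  · have h1 := he _ _ _ (hT x)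
    have h2 := hp (pad (T x) x)
    rw [length_pad] at h2
    have h3 : p.eval (T x + x.length) ≤ p.eval (t x + x.length) :=
      eval_mono p (Nat.add_le_add_right (hTt x) _)
    have h4 := Nat.mul_le_mul_left e (hTt x)
    have h5 := hTt x
    simp only [Polynomial.eval_add, Polynomial.eval_mul, Polynomial.eval_C, Polynomial.eval_X,
      Polynomial.eval_ofNat]
    nlinarith [Nat.zero_le (e * x.length)]
  · have hmem : ∀ x, pad (T x) x ∈ L ↔ x ∈ A.lang := fun x => by
      change T (unpad (pad (T x) x)) ≤ padding (pad (T x) x) ∧ unpad (pad (T x) x) ∈ A.lang ↔ _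
      rw [unpad_pad, padding_pad]
      exact and_iff_right le_rfl
    exact (congrArg (fun F => ComputesInTime F _) (funext fun x =>
      congrArg (fun b => [b]) (decide_eq_decide.2 (hmem x)))).mp hpad

end QParam

theorem mainTheorem3 : QParam.ClassFPT = QParam.ClassFPQT ↔ QParam.ClassP = QParam.ClassBQP :=
  ⟨fun h => QParam.classP_subset_classBQP.antisymm (QParam.classBQP_subset_classP h.ge),
    fun h => QParam.classFPT_subset_classFPQT.antisymm (QParam.classFPQT_subset_classFPT h.ge)⟩
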